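/- All programs are for the uniform-cost random access machine with addition and (truncated) subtraction on natural numbers. A conjunctive query $q$ (CQ) has a body of relational atoms and a list of head variables, all of which occur in the body; assume that distinct atoms of $q$ have distinct relation symbols. An instance $D$ of the schema gives each relation symbol a finite set of tuples of natural numbers; its size $|D|$ is the number of words of its description (for each relation, one word for its cardinality and one for each entry of each of its tuples), and $|q|$ is the number of symbols of $q$. Evaluating a query on $D$ means outputting every tuple of its answer on $D$ exactly once and nothing else. For a finite set $\mathcal I$ of inequalities $x\neq y$ between variables of $q$, the answer of $(q,\mathcal I)$ on $D$ consists of the head tuples of those valuations that map every atom of $q$ to a tuple of $D$ and satisfy all the inequalities in $\mathcal I$. **Theorem.** There is a constant $C>0$ such that the following holds for every such $q$ and $\mathcal I$ and every function $T$. Let $k$ be the number of variables that appear in $\mathcal I$, let $T(|q|,\cdot)$ be nondecreasing, and suppose that some program evaluates $q$ on every instance $D$ in time at most $T(|q|,|D|)$. Then some program evaluates $(q,\mathcal I)$ on every instance $D$ in time at most $$C\cdot 2^{\,C\,k\log k}\cdot\log(|D|+2)\cdot\max\bigl(T(|q|,|D|),\,|D|\bigr),$$ where $k\log k$ is read as $0$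 for $k=0$. In particular, if $T(|q|,n)\ge n$ for all $n$, then $(q,\mathcal I)$ can be evaluated in time $2^{O(k\log k)}\cdot\log|D|\cdot T(|q|,|D|)$ on instances with $|D|\ge 2$ (up to a universal constant factor). -/

import Mathlib

/-! ### Databases and conjunctive queries with inequalities -/

namespace CQ

/-- A relational schema: finitely many relation symbols, each with an arity. -/
structure Schema where
  numRel : ℕ
  arity : Fin numRel → ℕ

/-- A database instance. Values are natural numbers; every relation is a finite set of tuples,
given as a duplicate-free list (an enumeration of the set, in any order). -/
structure Database (S : Schema) where
  rel : (i : Fin S.numRel) → List (Fin (S.arity i) → ℕ)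
  nodup : ∀ i, (rel i).Nodup

/-- The size `|D|`: the number of machine words that describe `D`, namely, for every relation,
one word for its cardinality and one word for each entry of each of its tuples. -/
def Database.size {S : Schema} (D : Database S) : ℕ :=
  ∑ i, (1 + (D.rel i).length * S.arity i)

/-- An argument of a relational atom: a variable or a constant. -/
inductive Arg where
  | var (x : ℕ)
  | const (a : ℕ)

/-- The value of an argument under a valuation of the variables. -/
def Arg.val (ν : ℕ → ℕ) : Arg → ℕ
  | .var x => ν x
  | .const a => a

/-- A relational atom `R(a₁, …, a_m)`. -/
structure Atom (S : Schema) where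
  rel : Fin S.numRel
  args : Fin (S.arity rel) → Arg

/-- The set of variables that occur in a list of atoms. -/
def varsOf {S : Schema} (l : List (Atom S)) : Set ℕ :=
  {x | ∃ a ∈ l, ∃ j, a.args j = Arg.var x}

/-- A conjunctive query: a body of relational atoms, and a head listing the output variables,
all of which occur in the body. The query is Boolean if the head is empty. -/
structure Query (S : Schema) where
  atoms : List (Atom S)
  head : List ℕ
  safe : ∀ x ∈ head, x ∈ varsOf atoms

/-- The variables of the body of `q`. -/
def Query.vars {S : Schema} (q : Query S) : Set ℕ := varsOf q.atoms

/-- The size `|q|`: the number of symbols of the query. -/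
def Query.size {S : Schema} (q : Query S) : ℕ :=
  (q.atoms.map fun a => 1 + S.arity a.rel).sum + q.head.length

/-- Distinct atoms of the body have distinct relation symbols. -/
def Query.SelfJoinFree {S : Schema} (q : Query S) : Prop :=
  (q.atoms.map Atom.rel).Nodup

/-- The answer of the query with inequalities `(q, I)` on `D`, where `(x, y) ∈ I` stands for the
inequality `x ≠ y`: all head tuples of valuations that map every atom of the body to a tuple of
`D` and satisfy all the inequalities. For `I = ∅` this is the answer `q(D)` of `q`. -/
def Query.answer {S : Schema} (q : Query S) (I : Finset (ℕ × ℕ)) (D : Database S) :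
    Set (List ℕ) :=
  {t | ∃ ν : ℕ → ℕ,
      (∀ a ∈ q.atoms, (fun j => (a.args j).val ν) ∈ D.rel a.rel) ∧
      (∀ p ∈ I, ν p.1 ≠ ν p.2) ∧
      t = q.head.map ν}

/-- The variables that appear in the inequalities. -/
def ineqVars (I : Finset (ℕ × ℕ)) : Finset ℕ := I.image Prod.fst ∪ I.image Prod.snd

/-! ### Uniform-cost random access machines

The machine has a memory of finitely many arrays used by the program (addressed by fixed names),
each with cells indexed by natural numbers that hold natural numbers. It adds, subtracts, tests
for zero, reads and writes with computed addresses, and outputs tuples; programs are structured.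
Every elementary operation costs one step. -/

/-- Memory: array name, then index, to the content of the cell. -/
abbrev Memory := ℕ → ℕ → ℕ

/-- Expressions: constants, array reads, addition, truncated subtraction. -/
inductive Expr where
  | lit (n : ℕ)
  | read (arr : ℕ) (idx : Expr)
  | add (e₁ e₂ : Expr)
  | sub (e₁ e₂ : Expr)

/-- The value of an expression. -/
def Expr.eval (m : Memory) : Expr → ℕ
  | .lit n => n
  | .read a i => m a (i.eval m)
  | .add e₁ e₂ => e₁.eval m + e₂.eval m
  | .sub e₁ e₂ => e₁.eval m - e₂.eval m

/-- The number of steps for evaluating an expression: one per operation. -/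
def Expr.cost : Expr → ℕ
  | .lit _ => 1
  | .read _ i => i.cost + 1
  | .add e₁ e₂ => e₁.cost + e₂.cost + 1
  | .sub e₁ e₂ => e₁.cost + e₂.cost + 1

/-- Programs. -/
inductive Prog where
  | skip
  /-- `arr[idx] := e` -/
  | write (arr : ℕ) (idx e : Expr)
  /-- append the tuple of the values of `es` to the output -/
  | emit (es : List Expr)
  | seq (p₁ p₂ : Prog)
  /-- if `e ≠ 0` then `p₁` else `p₂` -/
  | cond (e : Expr) (p₁ p₂ : Prog)
  /-- while `e ≠ 0` do `p` -/
  | loop (e : Expr) (p : Prog)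

/-- A configuration: the memory, and the tuples output so far. -/
structure Config where
  mem : Memory
  out : List (List ℕ)

/-- `Exec p s s' t`: program `p`, started in configuration `s`, halts in configuration `s'` after
exactly `t` steps. -/
inductive Exec : Prog → Config → Config → ℕ → Prop
  | skip (s : Config) : Exec .skip s s 1
  | write (s : Config) (a : ℕ) (i e : Expr) :
      Exec (.write a i e) s
        ⟨Function.update s.mem a
          (Function.update (s.mem a) (i.eval s.mem) (e.eval s.mem)), s.out⟩
        (i.cost + e.cost + 1)
  | emit (s : Config) (es : List Expr) :
      Exec (.emit es) s
        ⟨s.mem, s.out ++ [es.map (Expr.eval s.mem)]⟩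
        ((es.map Expr.cost).sum + 1)
  | seq {p₁ p₂ : Prog} {s s' s'' : Config} {t₁ t₂ : ℕ} :
      Exec p₁ s s' t₁ → Exec p₂ s' s'' t₂ → Exec (.seq p₁ p₂) s s'' (t₁ + t₂)
  | condTrue {e : Expr} {p₁ p₂ : Prog} {s s' : Config} {t : ℕ} :
      e.eval s.mem ≠ 0 → Exec p₁ s s' t → Exec (.cond e p₁ p₂) s s' (e.cost + 1 + t)
  | condFalse {e : Expr} {p₁ p₂ : Prog} {s s' : Config} {t : ℕ} :
      e.eval s.mem = 0 → Exec p₂ s s' t → Exec (.cond e p₁ p₂) s s' (e.cost + 1 + t)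
  | loopDone {e : Expr} {p : Prog} {s : Config} :
      e.eval s.mem = 0 → Exec (.loop e p) s s (e.cost + 1)
  | loopStep {e : Expr} {p : Prog} {s s' s'' : Config} {t₁ t₂ : ℕ} :
      e.eval s.mem ≠ 0 → Exec p s s' t₁ → Exec (.loop e p) s' s'' t₂ →
      Exec (.loop e p) s s'' (e.cost + 1 + t₁ + t₂)

/-- The entries of a relation in row-major order. -/
def Database.cells {S : Schema} (D : Database S) (i : Fin S.numRel) : List ℕ :=
  (D.rel i).flatMap List.ofFn

/-- The initial memory on input `D`: cell `i` of array `0` holds the cardinality of the `i`-th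
relation, array `i + 1` holds the entries of the `i`-th relation in row-major order, and all the
other cells hold `0`. -/
def Database.initMem {S : Schema} (D : Database S) : Memory
  | 0, j => if h : j < S.numRel then (D.rel ⟨j, h⟩).length else 0
  | i + 1, j => if h : i < S.numRel then (D.cells ⟨i, h⟩).getD j 0 else 0

/-- The query with inequalities `(q, I)` can be evaluated in time `f(|D|)`: some program, on every
input `D`, halts within `f(|D|)` steps, having output every tuple of the answer exactly once and
nothing else. -/
def EvaluableInTime {S : Schema} (q : Query S) (I : Finset (ℕ × ℕ)) (f : ℕ → ℝ) : Prop :=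
  ∃ p : Prog, ∀ D : Database S, ∃ (s : Config) (t : ℕ),
    Exec p ⟨D.initMem, []⟩ s t ∧ (t : ℝ) ≤ f D.size ∧
    s.out.Nodup ∧ ∀ u, u ∈ s.out ↔ u ∈ q.answer I D

end CQ

/-! The method is derandomized colour coding. Colour the values of `D` with `K` colours, `K` a power
of two with `K ≥ 4 |I|`, and guess the colour `c x` of each variable in `I` so that the two sides of
every inequality receive different colours. Keep only those tuples of `D` whose entry at each
position of `x` has colour `c x`. As no relation symbol occurs twice in the body, each position
belongs to one argument of one atom, so this filter depends on `D` alone. Every answer of `q` on the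
filtered database comes from a valuation that satisfies `I`. Conversely, an answer of `(q, I)` is
found as soon as some colouring separates the values of its valuation along all inequalities. There
are at most `K ^ k` guesses per colouring.

The colourings are maps from `l`-bit numbers to `s`-bit numbers, `K = 2 ^ s`, linear over the field
with two elements, so `f` fails to separate `x` and `y` exactly when `f (x ^^^ y) = 0`. They are
chosen by multiplicative weights on the nonzero numbers. In each round the image of the bit `2 ^ i`
is picked greedily, so that at most a fraction `1 / K` of the weight between `2 ^ i` and `2 ^ (i +
1)` gets colour `0` (`IsRound`); these weights then double. The total weight grows by a factor of at
most `1 + 1 / K` per round. After `K * (l + 1)` rounds a nonzero number has had colour `0` at most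
`3 * l + 2` times (`IsHistory.countP_le`). Summed over at most `K / 4` inequalities this is less
than the number of rounds, so some round separates everything (`IsHistory.exists_separating`).

On the machine, `p` is run on all filtered databases in turn. Its memory is erased in constant time
by raising an offset, and answers found repeatedly are suppressed by a trie that persists through
all runs (`run_sim`). Choosing a colouring costs `O(K * 2 ^ l)` with `2 ^ l ≤ 2 * |D| + 1`, and each
run costs `O(|D| + T)`. The total is `O(K ^ (k + 2) * (l + 1) * max T |D|)` (`total_le`), and `K` is
polynomial in `k` because `|I| ≤ k ^ 2`. -/

namespace CQ

/-! ### Reasoning about programs -/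

/-- Program `p`, started with memory `m` and output `out`, halts within `T` steps, and the final
memory and output satisfy `Q`. -/
def Run (p : Prog) (m : Memory) (out : List (List ℕ)) (T : ℕ)
    (Q : Memory → List (List ℕ) → Prop) : Prop :=
  ∃ m' out' t, Exec p ⟨m, out⟩ ⟨m', out'⟩ t ∧ t ≤ T ∧ Q m' out'

section Rules

variable {p p₁ p₂ : Prog} {m : Memory} {out : List (List ℕ)} {T T' T₁ T₂ : ℕ}
  {Q Q' : Memory → List (List ℕ) → Prop} {e : Expr}

theorem Run.mono (h : Run p m out T Q) (hT : T ≤ T') (hQ : ∀ m' o, Q m' o → Q' m' o) :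
    Run p m out T' Q' := by
  obtain ⟨m', o, t, h, ht, hq⟩ := h
  exact ⟨m', o, t, h, ht.trans hT, hQ _ _ hq⟩

theorem Run.imp (h : Run p m out T Q) (hQ : ∀ m' o, Q m' o → Q' m' o) : Run p m out T Q' :=
  h.mono le_rfl hQ

theorem Run.le (h : Run p m out T Q) (hT : T ≤ T') : Run p m out T' Q :=
  h.mono hT fun _ _ h => h

theorem Run.skip (h : Q m out) : Run .skip m out 1 Q :=
  ⟨m, out, 1, .skip _, le_rfl, h⟩

theorem Run.seq (h : Run p₁ m out T₁ fun m' o => Run p₂ m' o T₂ Q) :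
    Run (.seq p₁ p₂) m out (T₁ + T₂) Q := by
  obtain ⟨m', o, t, h, ht, m'', o', t', h', ht', hq⟩ := h
  exact ⟨m'', o', t + t', .seq h h', add_le_add ht ht', hq⟩

theorem Run.write {a : ℕ} {i : Expr}
    (h : Q (Function.update m a (Function.update (m a) (i.eval m) (e.eval m))) out) :
    Run (.write a i e) m out (i.cost + e.cost + 1) Q :=
  ⟨_, _, _, .write _ _ _ _, le_rfl, h⟩

theorem Run.emit {es : List Expr} (h : Q m (out ++ [es.map (Expr.eval m)])) :
    Run (.emit es) m out ((es.map Expr.cost).sum + 1) Q :=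
  ⟨_, _, _, .emit _ _, le_rfl, h⟩

theorem Run.cond (h₁ : e.eval m ≠ 0 → Run p₁ m out T Q) (h₂ : e.eval m = 0 → Run p₂ m out T Q) :
    Run (.cond e p₁ p₂) m out (e.cost + 1 + T) Q := by
  by_cases he : e.eval m = 0
  · obtain ⟨m', o, t, h, ht, hq⟩ := h₂ he
    exact ⟨m', o, _, .condFalse he h, by omega, hq⟩
  · obtain ⟨m', o, t, h, ht, hq⟩ := h₁ he
    exact ⟨m', o, _, .condTrue he h, by omega, hq⟩

/-- A loop with an invariant indexed by the number of remaining iterations. -/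
theorem Run.loop (P : ℕ → Memory → List (List ℕ) → Prop) (cost : ℕ → ℕ)
    (hdone : ∀ m o, P 0 m o → e.eval m = 0)
    (hstep : ∀ n m o, P (n + 1) m o → e.eval m ≠ 0 ∧ Run p m o (cost n) (P n)) :
    ∀ n m out, P n m out →
      Run (.loop e p) m out (∑ j ∈ Finset.range n, (e.cost + 1 + cost j) + (e.cost + 1)) (P 0)
  | 0, m, out, h => ⟨m, out, _, .loopDone (hdone _ _ h), by simp, h⟩
  | n + 1, m, out, h => by
    obtain ⟨he, m', o, t, h', ht, hq⟩ := hstep _ _ _ h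
    obtain ⟨m'', o', t', h'', ht', hq'⟩ := Run.loop P cost hdone hstep n m' o hq
    refine ⟨m'', o', _, .loopStep he h' h'', ?_, hq'⟩
    rw [Finset.sum_range_succ]
    omega

end Rules

/-- Sequential composition of a list of programs. -/
def seqAll : List Prog → Prog
  | [] => .skip
  | p :: l => .seq p (seqAll l)

/-- Sequential composition with an invariant indexed by the list of programs already executed. -/
theorem Run.seqAll {α : Type*} (f : α → Prog) (P : List α → Memory → List (List ℕ) → Prop)
    (cost : α → ℕ) (l : List α)
    (hstep : ∀ pre x post, l = pre ++ x :: post → ∀ m o, P pre m o →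
      Run (f x) m o (cost x) (P (pre ++ [x]))) {m : Memory} {out : List (List ℕ)}
    (h : P [] m out) :
    Run (CQ.seqAll (l.map f)) m out ((l.map cost).sum + 1) (P l) := by
  suffices H : ∀ post pre, l = pre ++ post → ∀ m o, P pre m o →
      Run (CQ.seqAll (post.map f)) m o ((post.map cost).sum + 1) (P l) from H l [] rfl m out h
  intro post
  induction post with
  | nil =>
    intro pre hl m o h
    exact Run.skip (by simpa [hl] using h)
  | cons x post ih =>
    intro pre hl m o h
    refine (Run.seq ((hstep pre x post hl m o h).imp fun m' o' h' => ih (pre ++ [x]) ?_ m' o' h')).le ?_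
    · simp [hl]
    · simp; omega

/-! ### Memory layout

Arrays below `g` hold the input. The others are alternately registers of the evaluation
algorithm and arrays of a simulated program. -/

/-- The registers (scalars and arrays) of the evaluation algorithm. -/
inductive Reg where
  | base | high | tmp | node | trie | seen | next | width | dict | ids | size | rounds
  | pow | idx | color | weight | tally | best | arg | table | rem | src | dst | cnt | bad

/-- The index of a register. -/
def Reg.index : Reg → ℕ
  | base => 0 | high => 1 | tmp => 2 | node => 3 | trie => 4 | seen => 5 | next => 6 | width => 7
  | dict => 8 | ids => 9 | size => 10 | rounds => 11 | pow => 12 | idx => 13 | color => 14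
  | weight => 15 | tally => 16 | best => 17 | arg => 18 | table => 19 | rem => 20 | src => 21
  | dst => 22 | cnt => 23 | bad => 24

theorem Reg.index_injective : Function.Injective Reg.index := by
  intro a b h
  cases a <;> cases b <;> first | rfl | (exfalso; revert h; decide)

/-- The array that holds register `r`. -/
def arr (g : ℕ) (r : Reg) : ℕ := g + 2 * r.index

/-- The array that holds the array `a` of the simulated program. -/
def simArr (g a : ℕ) : ℕ := g + 2 * a + 1

@[simp] theorem arr_inj {g : ℕ} {r r' : Reg} : arr g r = arr g r' ↔ r = r' := by
  constructor
  · intro h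
    apply Reg.index_injective
    simp only [arr] at h
    omega
  · rintro rfl; rfl

@[simp] theorem simArr_inj {g a a' : ℕ} : simArr g a = simArr g a' ↔ a = a' := by
  simp only [simArr]; omega

@[simp] theorem arr_ne_simArr {g : ℕ} {r : Reg} {a : ℕ} : arr g r ≠ simArr g a := by
  simp only [arr, simArr]; omega

@[simp] theorem simArr_ne_arr {g : ℕ} {r : Reg} {a : ℕ} : simArr g a ≠ arr g r :=
  arr_ne_simArr.symm

theorem ne_arr_of_lt {g a : ℕ} (h : a < g) (r : Reg) : a ≠ arr g r := by
  simp only [arr]; omega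

theorem ne_simArr_of_lt {g a : ℕ} (h : a < g) (b : ℕ) : a ≠ simArr g b := by
  simp only [simArr]; omega

/-- The value of a scalar register. -/
def Expr.reg (g : ℕ) (r : Reg) : Expr := .read (arr g r) (.lit 0)

/-- An entry of an array register. -/
def Expr.get (g : ℕ) (r : Reg) (i : Expr) : Expr := .read (arr g r) i

/-- Assignment to a scalar register. -/
def Prog.set (g : ℕ) (r : Reg) (e : Expr) : Prog := .write (arr g r) (.lit 0) e

@[simp] theorem eval_lit (m : Memory) (n : ℕ) : (Expr.lit n).eval m = n := rfl
@[simp] theorem eval_read (m : Memory) (a : ℕ) (i : Expr) :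
    (Expr.read a i).eval m = m a (i.eval m) := rfl
@[simp] theorem eval_add (m : Memory) (e e' : Expr) :
    (Expr.add e e').eval m = e.eval m + e'.eval m := rfl
@[simp] theorem eval_sub (m : Memory) (e e' : Expr) :
    (Expr.sub e e').eval m = e.eval m - e'.eval m := rfl
@[simp] theorem eval_reg (m : Memory) (g : ℕ) (r : Reg) :
    (Expr.reg g r).eval m = m (arr g r) 0 := rfl
@[simp] theorem eval_get (m : Memory) (g : ℕ) (r : Reg) (i : Expr) :
    (Expr.get g r i).eval m = m (arr g r) (i.eval m) := rfl
@[simp] theorem cost_lit (n : ℕ) : (Expr.lit n).cost = 1 := rfl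
@[simp] theorem cost_read (a : ℕ) (i : Expr) : (Expr.read a i).cost = i.cost + 1 := rfl
@[simp] theorem cost_add (e e' : Expr) : (Expr.add e e').cost = e.cost + e'.cost + 1 := rfl
@[simp] theorem cost_sub (e e' : Expr) : (Expr.sub e e').cost = e.cost + e'.cost + 1 := rfl
@[simp] theorem cost_reg (g : ℕ) (r : Reg) : (Expr.reg g r).cost = 2 := rfl
@[simp] theorem cost_get (g : ℕ) (r : Reg) (i : Expr) : (Expr.get g r i).cost = i.cost + 1 := rfl

theorem Expr.one_le_cost (e : Expr) : 1 ≤ e.cost := by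
  cases e <;> simp

/-- Memory after the assignment of `v` to cell `i` of array `a`. -/
def Memory.put (m : Memory) (a i v : ℕ) : Memory :=
  Function.update m a (Function.update (m a) i v)

theorem Memory.put_apply (m : Memory) (a i v b : ℕ) :
    m.put a i v b = if b = a then Function.update (m a) i v else m b := by
  unfold Memory.put
  split_ifs with h
  · subst h; simp
  · simp [h]

@[simp] theorem Memory.put_same (m : Memory) (a i v : ℕ) :
    m.put a i v a = Function.update (m a) i v := by simp [put_apply]

@[simp] theorem Memory.put_ne (m : Memory) {a b : ℕ} (i v : ℕ) (h : b ≠ a) :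
    m.put a i v b = m b := by simp [put_apply, h]

section Rules

variable {g : ℕ} {m : Memory} {out : List (List ℕ)} {Q : Memory → List (List ℕ) → Prop}

theorem Run.put {a : ℕ} {i e : Expr} (h : Q (m.put a (i.eval m) (e.eval m)) out) :
    Run (.write a i e) m out (i.cost + e.cost + 1) Q := Run.write h

theorem Run.set {r : Reg} {e : Expr} (h : Q (m.put (arr g r) 0 (e.eval m)) out) :
    Run (.set g r e) m out (e.cost + 2) Q :=
  (Run.put (i := .lit 0) h).le (by simp; omega)

/-- Assignment followed by another program. -/
theorem Run.set_seq {r : Reg} {e : Expr} {p : Prog} {T : ℕ}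
    (h : Run p (m.put (arr g r) 0 (e.eval m)) out T Q) :
    Run (.seq (.set g r e) p) m out (e.cost + 2 + T) Q :=
  Run.seq (Run.set h)

theorem Run.put_seq {a : ℕ} {i e : Expr} {p : Prog} {T : ℕ}
    (h : Run p (m.put a (i.eval m) (e.eval m)) out T Q) :
    Run (.seq (.write a i e) p) m out (i.cost + e.cost + 1 + T) Q :=
  Run.seq (Run.put h)

end Rules

/-- The memories agree outside the arrays in `A`. -/
def Frame (A : Set ℕ) (m m' : Memory) : Prop := ∀ a, a ∉ A → m' a = m a

theorem Frame.refl (A : Set ℕ) (m : Memory) : Frame A m m := fun _ _ => rfl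

theorem Frame.trans {A : Set ℕ} {m m' m'' : Memory} (h : Frame A m m') (h' : Frame A m' m'') :
    Frame A m m'' := fun a ha => (h' a ha).trans (h a ha)

theorem Frame.mono {A A' : Set ℕ} {m m' : Memory} (h : Frame A m m') (hA : A ⊆ A') :
    Frame A' m m' := fun a ha => h a fun ha' => ha (hA ha')

theorem Frame.put {A : Set ℕ} {m m' : Memory} (h : Frame A m m') {a : ℕ} (ha : a ∈ A) (i v : ℕ) :
    Frame A m (m'.put a i v) := fun b hb => by
  rw [Memory.put_ne, h b hb]
  rintro rfl
  exact hb ha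

/-- The arrays of the registers in `A`. -/
def regs (g : ℕ) (A : Set Reg) : Set ℕ := arr g '' A

@[simp] theorem arr_mem_regs {g : ℕ} {A : Set Reg} {r : Reg} : arr g r ∈ regs g A ↔ r ∈ A := by
  simp [regs]

@[simp] theorem simArr_notMem_regs {g : ℕ} {A : Set Reg} {a : ℕ} : simArr g a ∉ regs g A := by
  simp [regs]

theorem notMem_regs_of_lt {g a : ℕ} (h : a < g) (A : Set Reg) : a ∉ regs g A := by
  rintro ⟨r, -, rfl⟩
  exact ne_arr_of_lt h r rfl

/-- The arrays of the simulated program. -/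
def simArrs (g : ℕ) : Set ℕ := Set.range (simArr g)

@[simp] theorem simArr_mem_simArrs {g a : ℕ} : simArr g a ∈ simArrs g := ⟨a, rfl⟩

@[simp] theorem arr_notMem_simArrs {g : ℕ} {r : Reg} : arr g r ∉ simArrs g := by
  simp [simArrs]

theorem notMem_simArrs_of_lt {g a : ℕ} (h : a < g) : a ∉ simArrs g := by
  rintro ⟨b, rfl⟩
  exact ne_simArr_of_lt h b rfl


/-! ### Simulation on memory that has been used before

A cell of the simulated program that holds `v` is stored as `v + base`. Since the old content of
all cells is at most `base`, they count as holding `0`, so that increasing `base` erases the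
simulated memory in constant time. -/

/-- The simulated memory. -/
def simMem (g : ℕ) (m : Memory) : Memory :=
  fun a i => m (simArr g a) i - m (arr g .base) 0

/-- The register `high` bounds the base and all the cells of the simulated memory. -/
def Capped (g : ℕ) (m : Memory) : Prop :=
  m (arr g .base) 0 ≤ m (arr g .high) 0 ∧ ∀ a i, m (simArr g a) i ≤ m (arr g .high) 0

/-- Expressions of the simulated program. -/
def Expr.sim (g : ℕ) : Expr → Expr
  | .lit n => .lit n
  | .read a i => .sub (.read (simArr g a) (i.sim g)) (.reg g .base)
  | .add e₁ e₂ => .add (e₁.sim g) (e₂.sim g)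
  | .sub e₁ e₂ => .sub (e₁.sim g) (e₂.sim g)

theorem eval_sim (g : ℕ) (m : Memory) (e : Expr) : (e.sim g).eval m = e.eval (simMem g m) := by
  induction e with
  | lit n => rfl
  | read a i ih => simp [Expr.sim, ih, simMem]
  | add e₁ e₂ h₁ h₂ => simp [Expr.sim, h₁, h₂]
  | sub e₁ e₂ h₁ h₂ => simp [Expr.sim, h₁, h₂]

/-- A read is the only operation that becomes dearer: subtracting the offset adds three steps to it.
-/
theorem cost_sim_le (g : ℕ) (e : Expr) : (e.sim g).cost ≤ 4 * e.cost := by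
  induction e with
  | lit n => simp [Expr.sim]
  | read a i ih => simp [Expr.sim]; omega
  | add e₁ e₂ h₁ h₂ => simp [Expr.sim]; omega
  | sub e₁ e₂ h₁ h₂ => simp [Expr.sim]; omega

/-- Arrays that affect neither the simulated memory nor its bounds. -/
theorem simMem_eq_of_frame {g : ℕ} {A : Set Reg} {m m' : Memory} (h : Frame (regs g A) m m')
    (hb : Reg.base ∉ A) : simMem g m' = simMem g m := by
  funext a i
  simp only [simMem]
  rw [h _ simArr_notMem_regs, h (arr g .base) (by simpa using hb)]

theorem Capped.of_frame {g : ℕ} {A : Set Reg} {m m' : Memory} (hc : Capped g m)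
    (h : Frame (regs g A) m m') (hb : Reg.base ∉ A) (hh : Reg.high ∉ A) : Capped g m' := by
  have h1 := h (arr g .base) (by simpa using hb)
  have h2 := h (arr g .high) (by simpa using hh)
  refine ⟨by rw [h1, h2]; exact hc.1, fun a i => ?_⟩
  rw [h2, h _ simArr_notMem_regs]
  exact hc.2 a i

/-- Assignment to a cell of the simulated memory. -/
def simWrite (g a : ℕ) (i e : Expr) : Prog :=
  .seq (.set g .tmp (.add (.reg g .base) e))
    (.seq (.write (simArr g a) i (.reg g .tmp))
      (.set g .high (.add (.reg g .high) (.sub (.reg g .tmp) (.reg g .high)))))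

/-- With truncated subtraction, `high + (tmp - high)` is the maximum of the two, so `high` stays an
upper bound. The index is evaluated after `tmp` has been overwritten, hence the condition `hi`; the
value `e` is evaluated before. -/
theorem run_simWrite {g a : ℕ} {i e : Expr} {m : Memory} {out : List (List ℕ)}
    (hc : Capped g m) (hi : ∀ v, i.eval (m.put (arr g .tmp) 0 v) = i.eval m) :
    Run (simWrite g a i e) m out (i.cost + e.cost + 20) fun m' o => o = out ∧
      simMem g m' = (simMem g m).put a (i.eval m) (e.eval m) ∧ Capped g m' ∧
      Frame (regs g {.tmp, .high} ∪ simArrs g) m m' := by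
  unfold simWrite
  refine (Run.set_seq (Run.put_seq (Run.set ⟨rfl, ?_, ?_, ?_⟩))).le (by simp; omega)
  · funext b j
    simp only [simMem, hi, Memory.put_apply]
    by_cases hb : b = a
    · subst hb
      by_cases hj : j = i.eval m
      · subst hj; simp
      · simp [hj, simMem]
    · simp [hb, simMem]
  · have h2 := hc.2
    have h1 := hc.1
    refine ⟨by simp [hi]; omega, fun b j => ?_⟩
    have := h2 b j
    simp only [hi, Memory.put_apply]
    by_cases hb : b = a
    · subst hb
      have := h2 b j
      by_cases hj : j = i.eval m
      · subst hj; simp; omega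
      · simp [hj]; omega
    · simp [hb]; omega
  · exact (((Frame.refl _ _).put (by simp) _ _).put (by simp) _ _).put (by simp) _ _

/-! ### Output without repetitions

The tuples that have been output are kept in a trie. Its nodes are multiples of a number `width`
that exceeds all the entries of the tuples; the child of the node `n` for the entry `v` is stored
in cell `n + v` of the array `trie`, and `0` means that there is no child. Tuples are read from
the last entry to the first. -/

/-- The node of a tuple. -/
def trieNode (tr : ℕ → ℕ) : List ℕ → ℕ
  | [] => 0
  | v :: l => tr (trieNode tr l + v)

/-- The tuple is a path of the trie. -/
def TriePath (tr : ℕ → ℕ) : List ℕ → Prop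
  | [] => True
  | v :: l => TriePath tr l ∧ tr (trieNode tr l + v) ≠ 0

/-- The invariant of the trie for tuples with entries below `B`; new nodes are taken from `next`. -/
structure TrieOk (B : ℕ) (tr : ℕ → ℕ) (next : ℕ) : Prop where
  inj : ∀ x y, tr x = tr y → tr x ≠ 0 → x = y
  dvd : ∀ x, B ∣ tr x
  lt : ∀ x, tr x < next
  dvd_next : B ∣ next

theorem TrieOk.dvd_node {B next : ℕ} {tr : ℕ → ℕ} (h : TrieOk B tr next) (l : List ℕ) :
    B ∣ trieNode tr l := by
  cases l with
  | nil => exact dvd_zero _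
  | cons v l => exact h.dvd _

/-- Uniqueness of division with remainder: a cell address of the trie determines the node and the
entry. -/
theorem add_inj_of_dvd {B n n' v v' : ℕ} (hn : B ∣ n) (hn' : B ∣ n') (hv : v < B) (hv' : v' < B)
    (h : n + v = n' + v') : n = n' ∧ v = v' := by
  obtain ⟨a, rfl⟩ := hn
  obtain ⟨b, rfl⟩ := hn'
  have h1 := congrArg (· % B) h
  simp only [Nat.mul_add_mod, Nat.mod_eq_of_lt hv, Nat.mod_eq_of_lt hv'] at h1
  omega

/-- A nonzero node occurs in a single cell, so paths can be traced back from their end. Only `l` has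
to be a path: the node of `l'` is then nonzero too as long as entries remain. -/
theorem TrieOk.node_inj {B next : ℕ} {tr : ℕ → ℕ} (h : TrieOk B tr next) {l : List ℕ} :
    ∀ {l' : List ℕ}, TriePath tr l → l.length = l'.length → (∀ v ∈ l, v < B) →
      (∀ v ∈ l', v < B) → trieNode tr l = trieNode tr l' → l = l' := by
  induction l with
  | nil =>
    intro l' _ hl _ _ _
    cases l' with
    | nil => rfl
    | cons => simp at hl
  | cons v l ih =>
    intro l' hp hl hB hB' he
    cases l' with
    | nil => simp at hl
    | cons v' l' =>
      obtain ⟨h1, h2⟩ := add_inj_of_dvd (h.dvd_node l) (h.dvd_node l') (hB v (by simp))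
        (hB' v' (by simp)) (h.inj _ _ he hp.2)
      rw [h2, ih hp.1 (by simpa using hl) (fun u hu => hB u (by simp [hu]))
        (fun u hu => hB' u (by simp [hu])) h1]

/-- Existing paths only use nonzero cells, so filling an empty cell does not disturb them. -/
theorem TriePath.update {tr : ℕ → ℕ} {x n : ℕ} (hx : tr x = 0) {l : List ℕ} (h : TriePath tr l) :
    TriePath (Function.update tr x n) l ∧ trieNode (Function.update tr x n) l = trieNode tr l := by
  induction l with
  | nil => exact ⟨trivial, rfl⟩
  | cons v l ih =>
    obtain ⟨h1, h2⟩ := ih h.1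
    have : trieNode tr l + v ≠ x := fun he => h.2 (by rw [he, hx])
    simp only [TriePath, trieNode, h2, Function.update_of_ne this]
    exact ⟨⟨h1, h.2⟩, trivial⟩

/-- The new node `next` exceeds everything stored so far, which preserves injectivity. -/
theorem TrieOk.update {B next : ℕ} {tr : ℕ → ℕ} (hB : 0 < B) (h : TrieOk B tr next) {x : ℕ} :
    TrieOk B (Function.update tr x next) (next + B) where
  inj y z hy h0 := by
    have h3 := h.lt y
    have h4 := h.lt z
    by_cases hyx : y = x <;> by_cases hzx : z = x
    · rw [hyx, hzx]
    · subst hyx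
      simp [hzx] at hy
      omega
    · subst hzx
      simp [hyx] at hy
      omega
    · simp [hyx, hzx] at hy h0
      exact h.inj _ _ hy h0
  dvd y := by
    by_cases hy : y = x
    · subst hy; simpa using h.dvd_next
    · simpa [hy] using h.dvd y
  lt y := by
    by_cases hy : y = x
    · subst hy; simpa using hB
    · simpa [hy] using (h.lt y).trans_le (Nat.le_add_right _ _)
  dvd_next := (Nat.dvd_add_right h.dvd_next).2 dvd_rfl

/-- The output consists of different tuples of length `h` with entries less than `width`, and it
is recorded in the trie. -/
structure Recorded (g h : ℕ) (m : Memory) (out : List (List ℕ)) : Prop where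
  width_pos : 0 < m (arr g .width) 0
  trie : TrieOk (m (arr g .width) 0) (m (arr g .trie)) (m (arr g .next) 0)
  nodup : out.Nodup
  length : ∀ u ∈ out, u.length = h
  lt : ∀ u ∈ out, ∀ v ∈ u, v < m (arr g .width) 0
  path : ∀ u ∈ out, TriePath (m (arr g .trie)) u ∧ m (arr g .seen) (trieNode (m (arr g .trie)) u) ≠ 0
  seen : ∀ n, m (arr g .seen) n ≠ 0 → ∃ u ∈ out, trieNode (m (arr g .trie)) u = n

/-- The registers on which `Recorded` depends. -/
theorem Recorded.congr {g h : ℕ} {m m' : Memory} {out : List (List ℕ)} (H : Recorded g h m out)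
    (h1 : m' (arr g .width) = m (arr g .width)) (h2 : m' (arr g .trie) = m (arr g .trie))
    (h3 : m' (arr g .next) = m (arr g .next)) (h4 : m' (arr g .seen) = m (arr g .seen)) :
    Recorded g h m' out := by
  obtain ⟨a, b, c, d, e, f, i⟩ := H
  constructor <;> (try simp only [h1, h2, h3, h4]) <;> assumption

/-- Descend in the trie from the current node along the entry `e`. -/
def descend (g : ℕ) (e : Expr) : Prog :=
  .seq (.set g .tmp (.add (.reg g .node) e))
    (.seq (.cond (.get g .trie (.reg g .tmp)) .skip
      (.seq (.write (arr g .trie) (.reg g .tmp) (.reg g .next))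
        (.set g .next (.add (.reg g .next) (.reg g .width)))))
      (.set g .node (.get g .trie (.reg g .tmp))))

/-- Walk to the node of a tuple. -/
def walk (g : ℕ) : List Expr → Prog
  | [] => .set g .node (.lit 0)
  | e :: es => .seq (walk g es) (descend g e)

/-- Output a tuple unless it has been output before. -/
def emitNew (g : ℕ) (es : List Expr) : Prog :=
  .seq (walk g es)
    (.cond (.get g .seen (.reg g .node)) .skip
      (.seq (.write (arr g .seen) (.reg g .node) (.lit 1)) (.emit es)))

/-- The registers that `emitNew` modifies. -/
def emitRegs : Set Reg := {.tmp, .node, .trie, .next, .seen}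

theorem run_descend {g h : ℕ} {e : Expr} {m : Memory} {out : List (List ℕ)} {l : List ℕ}
    (H : Recorded g h m out) (hp : TriePath (m (arr g .trie)) l)
    (hn : m (arr g .node) 0 = trieNode (m (arr g .trie)) l) :
    Run (descend g e) m out (e.cost + 35) fun m' o => o = out ∧ Recorded g h m' out ∧
      TriePath (m' (arr g .trie)) (e.eval m :: l) ∧
      m' (arr g .node) 0 = trieNode (m' (arr g .trie)) (e.eval m :: l) ∧
      Frame (regs g {.tmp, .node, .trie, .next}) m m' := by
  unfold descend
  refine (Run.set_seq (Run.seq (Run.cond (T := 20) (fun h0 => ?_) (fun h0 => ?_))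
    (T₂ := 6))).le (by simp; omega)
  · refine (Run.skip (Run.set ?_ |>.le (T' := 6) (by simp))).le (by simp)
    refine ⟨rfl, H.congr (by simp) (by simp) (by simp) (by simp), ?_, ?_, ?_⟩
    · simpa [TriePath, hn] using ⟨hp, by simpa [hn] using h0⟩
    · simp [trieNode, hn]
    · exact ((Frame.refl _ _).put (by simp) _ _).put (by simp) _ _
  · refine (Run.put_seq (Run.set (Run.set ?_ |>.le (T' := 6) (by simp)))).le (by simp)
    have h0' : m (arr g .trie) (trieNode (m (arr g .trie)) l + e.eval m) = 0 := by
      simpa [hn] using h0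
    obtain ⟨p1, p2⟩ := hp.update (n := m (arr g .next) 0) h0'
    have hpos : m (arr g .next) 0 ≠ 0 := by
      have := H.trie.lt 0
      omega
    refine ⟨rfl, ⟨?_, ?_, H.nodup, H.length, ?_, ?_, ?_⟩, ?_, ?_, ?_⟩
    · simpa using H.width_pos
    · simpa [hn] using H.trie.update H.width_pos
    · simpa using H.lt
    · intro u hu
      obtain ⟨q1, q2⟩ := H.path u hu
      obtain ⟨q3, q4⟩ := q1.update (n := m (arr g .next) 0) h0'
      simpa [hn, q4] using ⟨q3, q2⟩
    · intro n hn'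
      obtain ⟨u, hu, he⟩ := H.seen n (by simpa using hn')
      obtain ⟨q1, q2⟩ := H.path u hu
      obtain ⟨q3, q4⟩ := q1.update (n := m (arr g .next) 0) h0'
      exact ⟨u, hu, by simpa [hn, q4] using he⟩
    · simpa [TriePath, hn, p2] using ⟨p1, hpos⟩
    · simp [trieNode, hn, p2]
    · exact ((((Frame.refl _ _).put (by simp) _ _).put (by simp) _ _).put (by simp) _ _).put
        (by simp) _ _

theorem run_walk {g h : ℕ} {out : List (List ℕ)} {m : Memory} (es : List Expr)
    (hes : ∀ e ∈ es, ∀ m', Frame (regs g emitRegs) m m' → e.eval m' = e.eval m)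
    (H : Recorded g h m out) :
    Run (walk g es) m out ((es.map Expr.cost).sum + 35 * es.length + 3) fun m' o => o = out ∧
      Recorded g h m' out ∧ TriePath (m' (arr g .trie)) (es.map (Expr.eval m)) ∧
      m' (arr g .node) 0 = trieNode (m' (arr g .trie)) (es.map (Expr.eval m)) ∧
      Frame (regs g {.tmp, .node, .trie, .next}) m m' := by
  induction es with
  | nil =>
    refine (Run.set ?_).le (by simp)
    exact ⟨rfl, H.congr (by simp) (by simp) (by simp) (by simp), trivial, by simp [trieNode],
      (Frame.refl _ _).put (by simp) _ _⟩
  | cons e es ih =>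
    refine (Run.seq ((ih fun e' he' => hes e' (by simp [he'])).imp ?_)
      (T₂ := e.cost + 35)).le (by simp; omega)
    rintro m' o ⟨rfl, H', hp, hn, hF⟩
    refine (run_descend H' hp hn).imp ?_
    have he : e.eval m' = e.eval m := hes e (by simp) m' (hF.mono (Set.image_mono (by
      intro r hr; simp [emitRegs] at hr ⊢; tauto)))
    rintro m'' o ⟨rfl, H'', hp', hn', hF'⟩
    rw [he] at hp' hn'
    exact ⟨rfl, H'', hp', hn', hF.trans hF'⟩

/-- Walking to the node may create edges for a tuple that has not been output; only the mark in
`seen` records an output. The bound `hlt` makes node addresses unambiguous, and by `hes` the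
expressions still have their old values when the tuple is emitted after the walk. -/
theorem run_emitNew {g h : ℕ} {out : List (List ℕ)} {m : Memory} {es : List Expr}
    (hes : ∀ e ∈ es, ∀ m', Frame (regs g emitRegs) m m' → e.eval m' = e.eval m)
    (H : Recorded g h m out) (hlen : es.length = h)
    (hlt : ∀ e ∈ es, e.eval m < m (arr g .width) 0) :
    Run (emitNew g es) m out (40 * ((es.map Expr.cost).sum + 1)) fun m' o =>
      (∀ u, u ∈ o ↔ u ∈ out ∨ u = es.map (Expr.eval m)) ∧ Recorded g h m' o ∧
      Frame (regs g emitRegs) m m' := by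
  have hsum : es.length ≤ (es.map Expr.cost).sum := by
    clear hes hlen hlt
    induction es with
    | nil => simp
    | cons e es ih => have := e.one_le_cost; simp; omega
  have hsub : regs g {.tmp, .node, .trie, .next} ⊆ regs g emitRegs :=
    Set.image_mono (by intro r hr; simp [emitRegs] at hr ⊢; tauto)
  refine (Run.seq ((run_walk es hes H).imp ?_)
    (T₂ := (es.map Expr.cost).sum + 10)).le (by omega)
  rintro m' o ⟨rfl, H', hp, hn, hF⟩
  set u := es.map (Expr.eval m) with hu
  have hw : m' (arr g .width) = m (arr g .width) := hF _ (by simp)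
  have hulen : u.length = h := by simp [hu, hlen]
  have hult : ∀ v ∈ u, v < m' (arr g .width) 0 := by
    rw [hw]; simpa [hu] using hlt
  refine (Run.cond (T := (es.map Expr.cost).sum + 6) (fun h0 => ?_) (fun h0 => ?_)).le
    (by simp; omega)
  · refine (Run.skip ?_).le (by omega)
    refine ⟨fun w => ⟨Or.inl, ?_⟩, H', hF.mono hsub⟩
    rintro (hw | rfl)
    · exact hw
    -- A marked node belongs to some recorded tuple of the same length, which must be the present
    -- one.
    · obtain ⟨u', hu', he⟩ := H'.seen _ h0
      rw [eval_reg, hn] at he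
      have := H'.trie.node_inj (H'.path u' hu').1 ((H'.length u' hu').trans hulen.symm)
        (H'.lt u' hu') hult he
      rwa [← this]
  · have hmem : u ∉ o := by
      intro hmem
      have := (H'.path u hmem).2
      rw [← hn] at this
      exact this (by simpa using h0)
    have hF' : Frame (regs g emitRegs) m (m'.put (arr g .seen) (m' (arr g .node) 0) 1) :=
      (hF.mono hsub).put (by simp [emitRegs]) _ _
    have heq : es.map (Expr.eval (m'.put (arr g .seen) (m' (arr g .node) 0) 1)) = u := by
      rw [hu]
      exact List.map_congr_left fun e he => hes e he _ hF'
    refine (Run.put_seq (Run.emit ?_)).le (by simp; omega)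
    simp only [eval_reg, eval_lit, heq]
    refine ⟨by simp, ⟨?_, ?_, ?_, ?_, ?_, ?_, ?_⟩, hF'⟩
    · simpa using H'.width_pos
    · simpa using H'.trie
    · exact List.nodup_append.2 ⟨H'.nodup, by simp, by
        rintro a ha b hb rfl
        exact hmem (by simpa [← List.mem_singleton.1 hb] using ha)⟩
    · intro w hw
      rcases List.mem_append.1 hw with hw | hw
      · exact H'.length w hw
      · rw [List.mem_singleton.1 hw]; exact hulen
    · intro w hw
      rcases List.mem_append.1 hw with hw | hw
      · simpa using H'.lt w hw
      · rw [List.mem_singleton.1 hw]; simpa using hult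
    · intro w hw
      rcases List.mem_append.1 hw with hw | hw
      · have := H'.path w hw
        simp only [Memory.put_ne, ne_eq, arr_inj, reduceCtorEq, not_false_eq_true, Memory.put_same]
        refine ⟨this.1, ?_⟩
        rw [Function.update_apply]
        split_ifs
        · exact not_false
        · exact this.2
      · rw [List.mem_singleton.1 hw]
        simpa [hn] using hp
    · intro n hn'
      simp only [Memory.put_ne, ne_eq, arr_inj, reduceCtorEq, not_false_eq_true,
        Memory.put_same] at hn' ⊢
      by_cases hnn : n = m' (arr g .node) 0
      · exact ⟨u, by simp, by rw [hnn, hn]⟩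
      · rw [Function.update_of_ne hnn] at hn'
        obtain ⟨w, hw, he⟩ := H'.seen n hn'
        exact ⟨w, by simp [hw], he⟩

/-! ### Simulation of programs -/

/-- The simulated program. -/
def Prog.sim (g : ℕ) : Prog → Prog
  | .skip => .skip
  | .write a i e => simWrite g a (i.sim g) (e.sim g)
  | .emit es => emitNew g (es.map (Expr.sim g))
  | .seq p₁ p₂ => .seq (p₁.sim g) (p₂.sim g)
  | .cond e p₁ p₂ => .cond (e.sim g) (p₁.sim g) (p₂.sim g)
  | .loop e p => .loop (e.sim g) (p.sim g)

/-- The registers that a simulated program modifies. -/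
def simRegs : Set Reg := {.tmp, .node, .trie, .next, .seen, .high}

/-- Lets a condition on the tuples of the final output be used at every intermediate configuration
in `run_sim`. -/
theorem Exec.out_subset {p : Prog} {s s' : Config} {t : ℕ} (h : Exec p s s' t) :
    s.out ⊆ s'.out := by
  induction h with
  | skip => exact List.Subset.refl _
  | write => exact List.Subset.refl _
  | emit s es => exact List.subset_append_left _ _
  | seq _ _ h₁ h₂ => exact List.Subset.trans h₁ h₂
  | condTrue _ _ h => exact h
  | condFalse _ _ h => exact h
  | loopDone => exact List.Subset.refl _
  | loopStep _ _ _ h₁ h₂ => exact List.Subset.trans h₁ h₂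

theorem Exec.one_le {p : Prog} {s s' : Config} {t : ℕ} (h : Exec p s s' t) : 1 ≤ t := by
  induction h <;> omega

/-- Here `old` is what earlier runs have produced. Outputs are compared as sets only, since
repetitions are dropped. The factor `160` is `40` from `run_emitNew` times `4` from `cost_sim_le`.
-/
theorem run_sim {g h : ℕ} {p : Prog} {s s' : Config} {t : ℕ} (hx : Exec p s s' t)
    (B : ℕ) (old : List (List ℕ))
    (hgood : ∀ u ∈ s'.out, u.length = h ∧ ∀ v ∈ u, v < B) :
    ∀ (m : Memory) (out : List (List ℕ)), m (arr g .width) 0 = B → simMem g m = s.mem →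
      Capped g m → Recorded g h m out → (∀ u, u ∈ out ↔ u ∈ old ∨ u ∈ s.out) →
      Run (p.sim g) m out (160 * t) fun m' o => simMem g m' = s'.mem ∧ Capped g m' ∧
        Recorded g h m' o ∧ (∀ u, u ∈ o ↔ u ∈ old ∨ u ∈ s'.out) ∧
        Frame (regs g simRegs ∪ simArrs g) m m' := by
  induction hx with
  | skip s =>
    intro m out hB hs hc H ho
    exact (Run.skip ⟨hs, hc, H, ho, Frame.refl _ _⟩).le (by omega)
  | write s a i e =>
    intro m out hB hs hc H ho
    have h1 := cost_sim_le g i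
    have h2 := cost_sim_le g e
    refine (run_simWrite (a := a) (i := i.sim g) (e := e.sim g) hc ?_).mono (by omega) ?_
    · intro v
      rw [eval_sim, eval_sim, simMem_eq_of_frame (A := {.tmp})
        ((Frame.refl _ m).put (by simp) _ _) (by simp)]
    · rintro m' o ⟨rfl, h3, h4, h5⟩
      refine ⟨?_, h4, ?_, ho, h5.mono ?_⟩
      · rw [h3, eval_sim, eval_sim, hs]; rfl
      · exact H.congr (h5 _ (by simp)) (h5 _ (by simp)) (h5 _ (by simp)) (h5 _ (by simp))
      · refine Set.union_subset_union_left _ (Set.image_mono ?_)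
        intro r hr; simp [simRegs] at hr ⊢; tauto
  | emit s es =>
    intro m out hB hs hc H ho
    have hev : ∀ m', Frame (regs g emitRegs) m m' → simMem g m' = simMem g m := fun m' hF =>
      simMem_eq_of_frame hF (by simp [emitRegs])
    have hmap : (es.map (Expr.sim g)).map (Expr.eval m) = es.map (Expr.eval s.mem) := by
      simp [Function.comp_def, eval_sim, hs]
    obtain ⟨hl, hlt⟩ := hgood (es.map (Expr.eval s.mem)) (by simp)
    have hcost : ((es.map (Expr.sim g)).map Expr.cost).sum ≤ 4 * (es.map Expr.cost).sum := by
      clear hmap hl hlt hgood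
      induction es with
      | nil => simp
      | cons e es ih => have := cost_sim_le g e; simp at ih ⊢; omega
    refine (run_emitNew (es := es.map (Expr.sim g)) ?_ H (by simpa using hl) ?_).mono
      (by omega) ?_
    · intro e he m' hF
      obtain ⟨e, he, rfl⟩ := List.mem_map.1 he
      rw [eval_sim, eval_sim, hev m' hF]
    · intro e he
      obtain ⟨e, he, rfl⟩ := List.mem_map.1 he
      rw [eval_sim, hs, hB]
      exact hlt _ (List.mem_map.2 ⟨e, ‹_›, rfl⟩)
    · rintro m' o ⟨h1, h2, h3⟩
      refine ⟨by rw [hev m' h3, hs], hc.of_frame h3 (by simp [emitRegs]) (by simp [emitRegs]), h2,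
        fun u => ?_, h3.mono ?_⟩
      · rw [h1, ho, hmap]; simp [or_assoc]
      · refine (Set.image_mono ?_).trans Set.subset_union_left
        intro r hr; simp [simRegs, emitRegs] at hr ⊢; tauto
  | seq hx₁ hx₂ ih₁ ih₂ =>
    intro m out hB hs hc H ho
    refine (Run.seq ((ih₁ (fun u hu => hgood u (hx₂.out_subset hu)) m out hB hs hc H ho).imp
      fun m' o ⟨h1, h2, h3, h4, h5⟩ =>
      (ih₂ hgood m' o ((congrFun (h5 _ (by simp [simRegs])) 0).trans hB) h1 h2 h3 h4).imp
      fun m'' o' ⟨q1, q2, q3, q4, q5⟩ => ⟨q1, q2, q3, q4, h5.trans q5⟩)).le (by omega)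
  | condTrue he _ ih =>
    intro m out hB hs hc H ho
    refine (Run.cond (fun _ => ih hgood m out hB hs hc H ho) (fun h0 => ?_)).le ?_
    · rw [eval_sim, hs] at h0; exact absurd h0 he
    · rename_i e _ _ _ _ _ _; have := cost_sim_le g e; omega
  | condFalse he _ ih =>
    intro m out hB hs hc H ho
    refine (Run.cond (fun h0 => ?_) (fun _ => ih hgood m out hB hs hc H ho)).le ?_
    · rw [eval_sim, hs] at h0; exact absurd he h0
    · rename_i e _ _ _ _ _ _; have := cost_sim_le g e; omega
  | @loopDone e p s he =>
    intro m out hB hs hc H ho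
    have := cost_sim_le g e
    refine ⟨m, out, _, Exec.loopDone (by rw [eval_sim, hs]; exact he), by omega, hs, hc, H, ho,
      Frame.refl _ _⟩
  | @loopStep e p s s' s'' t₁ t₂ he hx₁ hx₂ ih₁ ih₂ =>
    intro m out hB hs hc H ho
    have := cost_sim_le g e
    obtain ⟨m', o, t, hr, ht, h1, h2, h3, h4, h5⟩ :=
      ih₁ (fun u hu => hgood u (hx₂.out_subset hu)) m out hB hs hc H ho
    obtain ⟨m'', o', t', hr', ht', q1, q2, q3, q4, q5⟩ :=
      ih₂ hgood m' o ((congrFun (h5 _ (by simp [simRegs])) 0).trans hB) h1 h2 h3 h4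
    exact ⟨m'', o', _, Exec.loopStep (by rw [eval_sim, hs]; exact he) hr hr', by omega, q1, q2, q3,
      q4, h5.trans q5⟩


/-! ### Loops over the tuples of a relation -/

/-- The first array that does not hold the input. -/
def Schema.top (S : Schema) : ℕ := S.numRel + 1

/-- The input is intact. -/
def InputOk {S : Schema} (D : Database S) (m : Memory) : Prop :=
  ∀ a < S.top, m a = D.initMem a

theorem InputOk.of_frame {S : Schema} {D : Database S} {m m' : Memory} (h : InputOk D m)
    {A : Set Reg} (hF : Frame (regs S.top A ∪ simArrs S.top) m m') : InputOk D m' :=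
  fun a ha => (hF a (by
    simp [notMem_regs_of_lt ha, notMem_simArrs_of_lt ha])).trans (h a ha)

theorem InputOk.of_frame_regs {S : Schema} {D : Database S} {m m' : Memory} (h : InputOk D m)
    {A : Set Reg} (hF : Frame (regs S.top A) m m') : InputOk D m' :=
  h.of_frame (hF.mono Set.subset_union_left)

theorem InputOk.card {S : Schema} {D : Database S} {m : Memory} (h : InputOk D m)
    (i : Fin S.numRel) : m 0 i = (D.rel i).length := by
  rw [h 0 (by simp [Schema.top])]
  simp [Database.initMem]

theorem InputOk.cell {S : Schema} {D : Database S} {m : Memory} (h : InputOk D m)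
    (i : Fin S.numRel) (j : ℕ) : m (i + 1) j = (D.cells i).getD j 0 := by
  rw [h (i + 1) (by simp [Schema.top])]
  simp [Database.initMem]

theorem length_flatMap_ofFn {r : ℕ} (l : List (Fin r → ℕ)) :
    (l.flatMap List.ofFn).length = l.length * r := by
  induction l with
  | nil => simp
  | cons t l ih => simp [ih, Nat.add_mul, add_comm]

theorem getD_flatMap_ofFn {r : ℕ} (pre post : List (Fin r → ℕ)) (t : Fin r → ℕ) (j : Fin r) :
    ((pre ++ t :: post).flatMap List.ofFn).getD (pre.length * r + j) 0 = t j := by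
  rw [List.flatMap_append, List.getD_append_right _ _ _ _ (by simp),
    length_flatMap_ofFn, Nat.add_sub_cancel_left, List.flatMap_cons,
    List.getD_append _ _ _ _ (by simp)]
  simp [List.getD_eq_getElem?_getD]

/-- Execute `body` for every tuple of the relation `i`. The entries of the current tuple are
the cells of array `i + 1` from `src` on. -/
def forTuples (S : Schema) (i : Fin S.numRel) (body : Prog) : Prog :=
  .seq (.set S.top .rem (.read 0 (.lit i)))
    (.seq (.set S.top .src (.lit 0))
      (.loop (.reg S.top .rem)
        (.seq body
          (.seq (.set S.top .src (.add (.reg S.top .src) (.lit (S.arity i))))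
            (.set S.top .rem (.sub (.reg S.top .rem) (.lit 1)))))))

/-- The invariant `P` is indexed by the tuples already processed. It must be insensitive to the loop
registers `rem` and `src`, which in turn the body must leave with their values. -/
theorem run_forTuples {S : Schema} (D : Database S) (i : Fin S.numRel) {body : Prog}
    (P : List (Fin (S.arity i) → ℕ) → Memory → List (List ℕ) → Prop) (c : ℕ)
    (hP : ∀ l m m' o, Frame (regs S.top {.rem, .src}) m m' → P l m o → P l m' o)
    (hin : ∀ l m o, P l m o → InputOk D m)
    (hbody : ∀ pre t m o, P pre m o →
      (∀ j : Fin (S.arity i), m (i + 1) (m (arr S.top .src) 0 + j) = t j) →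
      Run body m o c fun m' o' => P (pre ++ [t]) m' o' ∧
        m' (arr S.top .src) 0 = m (arr S.top .src) 0 ∧
        m' (arr S.top .rem) 0 = m (arr S.top .rem) 0)
    {m : Memory} {out : List (List ℕ)} (h : P [] m out) :
    Run (forTuples S i body) m out ((D.rel i).length * (c + 20) + 20) (P (D.rel i)) := by
  unfold forTuples
  have hloop := Run.loop (e := .reg S.top .rem)
    (p := .seq body (.seq (.set S.top .src (.add (.reg S.top .src) (.lit (S.arity i))))
            (.set S.top .rem (.sub (.reg S.top .rem) (.lit 1)))))
    (fun n m o => m (arr S.top .rem) 0 = n ∧ ∃ pre post, D.rel i = pre ++ post ∧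
      post.length = n ∧ m (arr S.top .src) 0 = pre.length * S.arity i ∧ P pre m o)
    (fun _ => c + 12) (fun m o h => h.1) (by
      rintro n m o ⟨hn, pre, post, hl, hpost, hsrc, hp⟩
      refine ⟨by simp [hn], ?_⟩
      obtain ⟨t, post, rfl⟩ : ∃ t post', post = t :: post' := by
        cases post with
        | nil => simp at hpost
        | cons t post => exact ⟨t, post, rfl⟩
      have hcell : ∀ j : Fin (S.arity i), m (i + 1) (m (arr S.top .src) 0 + j) = t j := by
        intro j
        rw [(hin _ _ _ hp).cell, hsrc, Database.cells, hl, getD_flatMap_ofFn]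
      refine (Run.seq ((hbody pre t m o hp hcell).imp ?_) (T₂ := 12)).le le_rfl
      rintro m' o' ⟨hp', h1, h2⟩
      refine (Run.set_seq (Run.set ?_)).le (by simp)
      refine ⟨by simp [h2, hn], pre ++ [t], post, by simp [hl], by simpa using hpost, ?_, ?_⟩
      · simp [h1, hsrc, Nat.succ_mul]
      · exact hP _ _ _ _ (((Frame.refl _ _).put (by simp) _ _).put (by simp) _ _) hp')
  refine (Run.set_seq (Run.set_seq ((hloop (D.rel i).length _ _ ⟨?_, [], D.rel i, rfl, rfl, ?_,
    ?_⟩).imp ?_))).le ?_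
  · simp [(hin _ _ _ h).card]
  · simp
  · exact hP _ _ _ _ (((Frame.refl _ _).put (by simp) _ _).put (by simp) _ _) h
  · rintro m' o' ⟨-, pre, post, hl, hpost, -, hp⟩
    rw [List.length_eq_zero_iff.1 hpost, List.append_nil] at hl
    rwa [hl]
  · simp only [cost_read, cost_lit, cost_reg, Finset.sum_const, Finset.card_range, smul_eq_mul]
    have : (D.rel i).length * (2 + 1 + (c + 12)) ≤ (D.rel i).length * (c + 20) :=
      Nat.mul_le_mul_left _ (by omega)
    omega

/-! ### The cost of one pass over the database. -/

theorem length_le_one_of_arity_eq_zero {S : Schema} (D : Database S) {i : Fin S.numRel}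
    (h : S.arity i = 0) : (D.rel i).length ≤ 1 := by
  have : Subsingleton (Fin (S.arity i) → ℕ) := by rw [h]; infer_instance
  by_contra! h1
  exact absurd (List.nodup_iff_injective_get.1 (D.nodup i)
    (Subsingleton.elim ((D.rel i).get ⟨0, by omega⟩) ((D.rel i).get ⟨1, by omega⟩))) (by simp)

/-- The size counts entries rather than tuples. A tuple of positive arity pays for its own overhead,
and a nullary relation has at most one tuple, paid for by the word for its cardinality. -/
theorem sum_relation_cost_le {S : Schema} (D : Database S) (a b : ℕ) :
    ((List.finRange S.numRel).map
      fun i => a * ((D.rel i).length * (S.arity i + 1)) + b).sum ≤ (2 * a + b) * D.size := by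
  rw [← Fin.sum_univ_def, Database.size, Finset.mul_sum]
  refine Finset.sum_le_sum fun i _ => ?_
  have : (D.rel i).length * (S.arity i + 1) ≤ 2 * (1 + (D.rel i).length * S.arity i) := by
    rcases Nat.eq_zero_or_pos (S.arity i) with h | h
    · have := length_le_one_of_arity_eq_zero D h
      simp only [h]; omega
    · have := Nat.mul_le_mul_left (D.rel i).length h
      rw [Nat.mul_add]; omega
  calc a * ((D.rel i).length * (S.arity i + 1)) + b
      ≤ a * (2 * (1 + (D.rel i).length * S.arity i)) + b * (1 + (D.rel i).length * S.arity i) :=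
        add_le_add (Nat.mul_le_mul_left _ this) (Nat.le_mul_of_pos_right _ (by omega))
    _ = _ := by ring

/-! ### Numbering the values of a database -/

/-- The values in `l` are numbered injectively from `1` on, and they are less than `width`. -/
structure Scanned (g : ℕ) (l : List ℕ) (m : Memory) : Prop where
  width_pos : 0 < m (arr g .width) 0
  lt : ∀ v ∈ l, v < m (arr g .width) 0
  ne : ∀ v ∈ l, m (arr g .dict) v ≠ 0
  le : ∀ v, m (arr g .dict) v ≤ m (arr g .ids) 0
  inj : ∀ v w, m (arr g .dict) v = m (arr g .dict) w → m (arr g .dict) v ≠ 0 → v = w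
  ids_le : m (arr g .ids) 0 ≤ l.length

theorem Scanned.congr {g : ℕ} {l : List ℕ} {m m' : Memory} (H : Scanned g l m)
    (h1 : m' (arr g .width) = m (arr g .width)) (h2 : m' (arr g .dict) = m (arr g .dict))
    (h3 : m' (arr g .ids) = m (arr g .ids)) : Scanned g l m' := by
  obtain ⟨a, b, c, d, e, f⟩ := H
  constructor <;> (try simp only [h1, h2, h3]) <;> assumption

/-- Number the value of `e`. -/
def scanValue (g : ℕ) (e : Expr) : Prog :=
  .seq (.set g .tmp e)
    (.seq (.set g .width (.add (.reg g .width)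
        (.sub (.add (.reg g .tmp) (.lit 1)) (.reg g .width))))
      (.cond (.get g .dict (.reg g .tmp)) .skip
        (.seq (.set g .ids (.add (.reg g .ids) (.lit 1)))
          (.write (arr g .dict) (.reg g .tmp) (.reg g .ids)))))

/-- `width` becomes the maximum of itself and the value plus one. A fresh number is `ids + 1`,
larger than all numbers in use, so the numbering stays injective. -/
theorem run_scanValue {g : ℕ} {e : Expr} {l : List ℕ} {m : Memory} {out : List (List ℕ)}
    (H : Scanned g l m) :
    Run (scanValue g e) m out (e.cost + 40) fun m' o => o = out ∧
      Scanned g (l ++ [e.eval m]) m' ∧ Frame (regs g {.tmp, .width, .dict, .ids}) m m' := by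
  unfold scanValue
  refine (Run.set_seq (Run.set_seq (Run.cond (T := 20) (fun h0 => ?_) (fun h0 => ?_)))).le
    (by simp)
  · refine (Run.skip ⟨rfl, ⟨?_, ?_, ?_, ?_, ?_, ?_⟩, ?_⟩).le (by simp)
    · have := H.width_pos; simp; omega
    · intro v hv
      rcases List.mem_append.1 hv with hv | hv
      · have := H.lt v hv; simp; omega
      · rw [List.mem_singleton.1 hv]; simp; try omega
    · intro v hv
      rcases List.mem_append.1 hv with hv | hv
      · simpa using H.ne v hv
      · rw [List.mem_singleton.1 hv]; simpa using h0
    · simpa using H.le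
    · simpa using H.inj
    · have := H.ids_le; simp; omega
    · exact ((Frame.refl _ _).put (by simp) _ _).put (by simp) _ _
  · refine (Run.set_seq (Run.put ⟨rfl, ⟨?_, ?_, ?_, ?_, ?_, ?_⟩, ?_⟩)).le (by simp)
    · have := H.width_pos; simp; omega
    · intro v hv
      rcases List.mem_append.1 hv with hv | hv
      · have := H.lt v hv; simp; omega
      · rw [List.mem_singleton.1 hv]; simp; omega
    · intro v hv
      by_cases hve : v = e.eval m
      · simp [hve]
      · have : v ∈ l := by simpa [hve] using hv
        simpa [hve] using H.ne v this
    · intro v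
      have := H.le v
      by_cases hve : v = e.eval m
      · simp [hve]
      · simp [hve]; omega
    · intro v w hvw hv0
      have hv := H.le v
      have hw := H.le w
      by_cases hve : v = e.eval m <;> by_cases hwe : w = e.eval m
      · rw [hve, hwe]
      · simp [hve, hwe] at hvw; omega
      · simp [hve, hwe] at hvw; omega
      · simp [hve, hwe] at hvw hv0
        exact H.inj _ _ hvw hv0
    · have := H.ids_le; simp; omega
    · exact ((((Frame.refl _ _).put (by simp) _ _).put (by simp) _ _).put (by simp) _ _).put
        (by simp) _ _

/-- Number all the values of the database. -/
def scanAll (S : Schema) : Prog :=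
  .seq (.set S.top .width (.lit 1))
    (seqAll ((List.finRange S.numRel).map fun i => forTuples S i
      (seqAll ((List.finRange (S.arity i)).map fun j : Fin (S.arity i) =>
        scanValue S.top (.read (i + 1) (.add (.reg S.top .src) (.lit j)))))))

/-- The registers that `scanAll` modifies. -/
def scanRegs : Set Reg := {.tmp, .width, .dict, .ids, .rem, .src}

theorem run_scanAll {S : Schema} (D : Database S) {m : Memory} {out : List (List ℕ)}
    (hin : InputOk D m) (hids : m (arr S.top .ids) 0 = 0)
    (hdict : ∀ v, m (arr S.top .dict) v = 0) :
    Run (scanAll S) m out (200 * D.size + 10) fun m' o => o = out ∧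
      Scanned S.top ((List.finRange S.numRel).flatMap D.cells) m' ∧
      Frame (regs S.top scanRegs) m m' := by
  unfold scanAll
  set m₁ := m.put (arr S.top .width) 0 1
  have hF₁ : Frame (regs S.top scanRegs) m m₁ := (Frame.refl _ _).put (by simp [scanRegs]) _ _
  refine (Run.set_seq (((Run.seqAll _ (fun pre m' o => o = out ∧
    Scanned S.top (pre.flatMap D.cells) m' ∧ Frame (regs S.top scanRegs) m m')
    (fun i => 60 * ((D.rel i).length * (S.arity i + 1)) + 20) (List.finRange S.numRel) ?_ ?_).imp
    fun m' o h => h).le (add_le_add_left (sum_relation_cost_le D _ _) 1))).le (by simp; omega)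
  · rintro pre i post - m' o ⟨rfl, hs, hF⟩
    refine (run_forTuples D i (fun l m' o' => o' = o ∧
      Scanned S.top (pre.flatMap D.cells ++ l.flatMap List.ofFn) m' ∧
      Frame (regs S.top scanRegs) m m') (50 * S.arity i + 1) ?_ ?_ ?_ ?_).mono ?_ ?_
    · rintro l m' m'' o' hF' ⟨h1, h2, h3⟩
      exact ⟨h1, h2.congr (hF' _ (by simp)) (hF' _ (by simp)) (hF' _ (by simp)),
        h3.trans (hF'.mono (Set.image_mono (by intro r hr; simp [scanRegs] at hr ⊢; tauto)))⟩
    · rintro l m' o' ⟨h1, h2, h3⟩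
      exact hin.of_frame_regs h3
    · rintro l t m' o' ⟨rfl, hs, hF⟩ ht
      have hi : ∀ A, ((i : ℕ) + 1) ∉ regs S.top A := fun A =>
        notMem_regs_of_lt (by simp [Schema.top]) A
      refine ((Run.seqAll _ (fun l' m'' o => o = o' ∧
        Scanned S.top (pre.flatMap D.cells ++ l.flatMap List.ofFn ++ l'.map t) m'' ∧
        Frame (regs S.top {.tmp, .width, .dict, .ids}) m' m'')
        (fun j => 50) (List.finRange (S.arity i)) ?_ ?_).mono ?_ ?_)
      · rintro l' j post' - m'' o ⟨rfl, hs', hF'⟩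
        refine (run_scanValue hs').mono (by simp) ?_
        rintro m₃ o ⟨rfl, hs₃, hF₃⟩
        refine ⟨rfl, ?_, hF'.trans hF₃⟩
        have : (Expr.read (↑i + 1) (.add (.reg S.top .src) (.lit j))).eval m'' = t j := by
          simp only [eval_read, eval_add, eval_reg, eval_lit]
          rw [hF' _ (hi _), hF' (arr S.top .src) (by simp), ht]
        rw [this] at hs₃
        simpa using hs₃
      · exact ⟨rfl, by simpa using hs, Frame.refl _ _⟩
      · simp [mul_comm]
      · rintro m'' o ⟨rfl, hs', hF'⟩
        refine ⟨⟨rfl, ?_, hF.trans (hF'.mono (Set.image_mono (by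
          intro r hr; simp [scanRegs] at hr ⊢; tauto)))⟩, ?_, ?_⟩
        · simpa [List.ofFn_eq_map] using hs'
        · rw [hF' _ (by simp)]
        · rw [hF' _ (by simp)]
    · exact ⟨rfl, by simpa using hs, hF⟩
    · have : (D.rel i).length * (50 * S.arity i + 1 + 20) ≤
          (D.rel i).length * (60 * (S.arity i + 1)) := Nat.mul_le_mul_left _ (by omega)
      calc _ ≤ (D.rel i).length * (60 * (S.arity i + 1)) + 20 := by omega
        _ = _ := by ring
    · rintro m'' o' ⟨rfl, h1, h2⟩
      exact ⟨rfl, by simpa [Database.cells] using h1, h2⟩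
  · refine ⟨rfl, ⟨?_, ?_, ?_, ?_, ?_, ?_⟩, hF₁⟩
    · simp
    · simp
    · simp
    · simp [hdict]
    · simp [hdict]
    · simp [hids]

/-! ### Loading a filtered database into the simulated memory -/

/-- The tuple has the required colours: where `req j = some c`, the colour of its entry at
position `j` is `c`. -/
def Keeps {r : ℕ} (col : ℕ → ℕ) (req : Fin r → Option ℕ) (t : Fin r → ℕ) : Prop :=
  ∀ j c, req j = some c → col (t j) = c

open Classical in
/-- The tuples that have the required colours. -/
noncomputable def Database.restrict {S : Schema} (D : Database S) (col : ℕ → ℕ)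
    (req : (i : Fin S.numRel) → Fin (S.arity i) → Option ℕ) : Database S where
  rel i := (D.rel i).filter fun t => Keeps col (req i) t
  nodup i := (D.nodup i).filter _

theorem Database.size_restrict_le {S : Schema} (D : Database S) (col : ℕ → ℕ)
    (req : (i : Fin S.numRel) → Fin (S.arity i) → Option ℕ) :
    (D.restrict col req).size ≤ D.size :=
  Finset.sum_le_sum fun _ _ => Nat.add_le_add_left
    (Nat.mul_le_mul_right _ (List.length_filter_le _ _)) _

/-- Add to `bad` the distance of the colour at position `j` of the current tuple from `c`. -/
def checkEntry (g i j : ℕ) : Option ℕ → Prog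
  | none => .skip
  | some c =>
    let e := .get g .color (.get g .dict (.read (i + 1) (.add (.reg g .src) (.lit j))))
    .set g .bad (.add (.reg g .bad) (.add (.sub e (.lit c)) (.sub (.lit c) e)))

/-- Copy the entry at position `j` of the current tuple to the simulated memory. -/
def copyEntry (g i j : ℕ) : Prog :=
  .seq (simWrite g (i + 1) (.reg g .dst) (.read (i + 1) (.add (.reg g .src) (.lit j))))
    (.set g .dst (.add (.reg g .dst) (.lit 1)))

/-- Copy the current tuple if it has the required colours. -/
def loadTuple (g i : ℕ) {r : ℕ} (req : Fin r → Option ℕ) : Prog :=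
  .seq (.set g .bad (.lit 0))
    (.seq (seqAll ((List.finRange r).map fun j : Fin r => checkEntry g i j (req j)))
      (.cond (.reg g .bad) .skip
        (.seq (seqAll ((List.finRange r).map fun j : Fin r => copyEntry g i j))
          (.set g .cnt (.add (.reg g .cnt) (.lit 1))))))

/-- Load the tuples of the relation `i` that have the required colours. -/
def loadRel (S : Schema) (i : Fin S.numRel) (req : Fin (S.arity i) → Option ℕ) : Prog :=
  .seq (.set S.top .dst (.lit 0))
    (.seq (.set S.top .cnt (.lit 0))
      (.seq (forTuples S i (loadTuple S.top i req))
        (simWrite S.top 0 (.lit i) (.reg S.top .cnt))))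

/-- Erase the simulated memory and load the tuples that have the required colours. -/
def loadAll (S : Schema) (req : (i : Fin S.numRel) → Fin (S.arity i) → Option ℕ) : Prog :=
  .seq (.set S.top .base (.reg S.top .high))
    (seqAll ((List.finRange S.numRel).map fun i => loadRel S i (req i)))

/-- A sum of distances vanishes only if all the distances do. -/
theorem run_checks {g i r : ℕ} (hi : i + 1 < g) (req : Fin r → Option ℕ) {t : Fin r → ℕ}
    {m : Memory} {out : List (List ℕ)} (hbad : m (arr g .bad) 0 = 0)
    (ht : ∀ j : Fin r, m (i + 1) (m (arr g .src) 0 + j) = t j) :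
    Run (seqAll ((List.finRange r).map fun j : Fin r => checkEntry g i j (req j))) m out (30 * r + 1)
      fun m' o => o = out ∧ Frame (regs g {.bad}) m m' ∧
        (m' (arr g .bad) 0 = 0 ↔
          Keeps (fun v => m (arr g .color) (m (arr g .dict) v)) req t) := by
  refine (Run.seqAll _ (fun l m' o => o = out ∧ Frame (regs g {.bad}) m m' ∧
    (m' (arr g .bad) 0 = 0 ↔ ∀ j ∈ l, ∀ c, req j = some c →
      m (arr g .color) (m (arr g .dict) (t j)) = c)) (fun _ => 30) (List.finRange r) ?_ ?_).mono
      ?_ ?_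
  · rintro pre j post - m' o ⟨rfl, hF, hb⟩
    cases hr : req j with
    | none =>
      refine (Run.skip ⟨rfl, hF, hb.trans ?_⟩).le (by omega)
      simp [or_imp, forall_and, hr]
    | some c =>
      have hv : m' (i + 1) (m' (arr g .src) 0 + j) = t j := by
        rw [hF _ (notMem_regs_of_lt hi _), hF (arr g .src) (by simp), ht]
      have h1 : m' (arr g .color) = m (arr g .color) := hF _ (by simp)
      have h2 : m' (arr g .dict) = m (arr g .dict) := hF _ (by simp)
      refine (Run.set ⟨rfl, hF.put (by simp) _ _, ?_⟩).le (by simp)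
      simp only [eval_add, eval_sub, eval_get, eval_read, eval_reg, eval_lit, hv, h1, h2,
        Memory.put_same, Function.update_self, List.mem_append, List.mem_singleton, or_imp,
        forall_and, ← hb, forall_eq, hr, Option.some.injEq]
      rw [forall_eq']
      omega
  · exact ⟨rfl, Frame.refl _ _, by simp [hbad]⟩
  · simp [mul_comm]
  · rintro m' o ⟨h1, h2, h3⟩
    refine ⟨h1, h2, h3.trans ?_⟩
    simp [Keeps]

/-- Writing just past the end appends: the default `0` beyond the list agrees with erased memory. -/
theorem update_getD_length (l : List ℕ) (v : ℕ) :
    Function.update (fun j => l.getD j 0) l.length v = fun j => (l ++ [v]).getD j 0 := by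
  funext j
  rw [Function.update_apply]
  split_ifs with h
  · subst h; simp [List.getD_eq_getElem?_getD]
  · rcases lt_or_gt_of_ne h with h | h
    · rw [List.getD_append _ _ _ _ h]
    · rw [List.getD_eq_default _ _ (by simpa using h.le), List.getD_eq_default _ _ (by simpa using h)]

theorem run_copy {g i r : ℕ} (hi : i + 1 < g) {t : Fin r → ℕ} {m : Memory}
    {out : List (List ℕ)} (hc : Capped g m) {l : List ℕ}
    (hl : simMem g m (i + 1) = fun j => l.getD j 0) (hdst : m (arr g .dst) 0 = l.length)
    (ht : ∀ j : Fin r, m (i + 1) (m (arr g .src) 0 + j) = t j) :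
    Run (seqAll ((List.finRange r).map fun j : Fin r => copyEntry g i j)) m out (40 * r + 1)
      fun m' o => o = out ∧ Capped g m' ∧
        Frame (regs g {.tmp, .high, .dst} ∪ simArrs g) m m' ∧
        simMem g m' = Function.update (simMem g m) (i + 1) (fun j => (l ++ List.ofFn t).getD j 0) ∧
        m' (arr g .dst) 0 = (l ++ List.ofFn t).length := by
  refine (Run.seqAll _ (fun l' m' o => o = out ∧ Capped g m' ∧
        Frame (regs g {.tmp, .high, .dst} ∪ simArrs g) m m' ∧
        simMem g m' = Function.update (simMem g m) (i + 1) (fun j => (l ++ l'.map t).getD j 0) ∧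
        m' (arr g .dst) 0 = (l ++ l'.map t).length) (fun _ => 40) (List.finRange r) ?_ ?_).mono
      ?_ ?_
  · rintro pre j post - m' o ⟨rfl, hc, hF, hs, hd⟩
    have hv : m' (i + 1) (m' (arr g .src) 0 + j) = t j := by
      rw [hF _ (by simp [notMem_regs_of_lt hi, notMem_simArrs_of_lt hi]),
        hF (arr g .src) (by simp), ht]
    refine (Run.seq ((run_simWrite hc (by simp)).imp ?_) (T₂ := 10)).le (by simp)
    rintro m'' o ⟨rfl, h1, h2, h3⟩
    have hd' : m'' (arr g .dst) 0 = m' (arr g .dst) 0 := by rw [h3 _ (by simp)]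
    have hF2 : Frame (regs g {.dst}) m'' (m''.put (arr g .dst) 0 (m'' (arr g .dst) 0 + 1)) :=
      (Frame.refl _ _).put (by simp) _ _
    refine (Run.set ⟨rfl, ?_, ?_, ?_, ?_⟩).le (by simp)
    · exact h2.of_frame hF2 (by simp) (by simp)
    · refine (hF.trans (h3.mono ?_)).put (by simp) _ _
      exact Set.union_subset_union_left _ (Set.image_mono (by
        intro r hr; simp at hr ⊢; tauto))
    · refine (simMem_eq_of_frame (A := {.dst}) hF2 (by simp)).trans ?_
      rw [h1, hs]
      simp only [eval_reg, hd, Memory.put, Function.update_self, Function.update_idem,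
        update_getD_length, eval_read, eval_add, eval_lit]
      rw [hv]
      simp
    · simp [hd', hd]; omega
  · refine ⟨rfl, hc, Frame.refl _ _, ?_, by simp [hdst]⟩
    simp only [List.map_nil, List.append_nil, ← hl, Function.update_eq_self]
  · simp [mul_comm]
  · rintro m' o ⟨h1, h2, h3, h4, h5⟩
    exact ⟨h1, h2, h3, by simpa [List.ofFn_eq_map] using h4, by simpa using h5⟩

/-- The registers that loading modifies. -/
def loadRegs : Set Reg := {.tmp, .high, .dst, .cnt, .bad, .rem, .src}

theorem regs_loadRegs_mono {g : ℕ} {A : Set Reg} (h : A ⊆ loadRegs) :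
    regs g A ∪ simArrs g ⊆ regs g loadRegs ∪ simArrs g :=
  Set.union_subset_union_left _ (Set.image_mono h)

/-- The hypothesis `h0` says that the target array has been erased, so nothing follows the copied
entries. -/
theorem run_loadRel {S : Schema} (D : Database S) (col : ℕ → ℕ)
    (req : (i : Fin S.numRel) → Fin (S.arity i) → Option ℕ) (i : Fin S.numRel) {m : Memory}
    {out : List (List ℕ)} (hin : InputOk D m) (hc : Capped S.top m)
    (h0 : ∀ j, simMem S.top m (i + 1) j = 0)
    (hcol : ∀ v, m (arr S.top .color) (m (arr S.top .dict) v) = col v) :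
    Run (loadRel S i (req i)) m out (100 * ((D.rel i).length * (S.arity i + 1)) + 60) fun m' o =>
      o = out ∧ Capped S.top m' ∧ Frame (regs S.top loadRegs ∪ simArrs S.top) m m' ∧
      simMem S.top m' = Memory.put (Function.update (simMem S.top m) (i + 1)
        (fun j => ((D.restrict col req).cells i).getD j 0)) 0 i
        ((D.restrict col req).rel i).length := by
  classical
  have hi : (i : ℕ) + 1 < S.top := by simp [Schema.top]
  have hloop := run_forTuples D i (body := loadTuple S.top i (req i))
    (fun l m' o => o = out ∧ Capped S.top m' ∧
      Frame (regs S.top loadRegs ∪ simArrs S.top) m m' ∧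
      simMem S.top m' = Function.update (simMem S.top m) (i + 1)
        (fun j => ((l.filter fun t => Keeps col (req i) t).flatMap List.ofFn).getD j 0) ∧
      m' (arr S.top .dst) 0 = ((l.filter fun t => Keeps col (req i) t).flatMap List.ofFn).length ∧
      m' (arr S.top .cnt) 0 = (l.filter fun t => Keeps col (req i) t).length)
    (70 * S.arity i + 30) ?_ ?_ ?_ (m := (m.put (arr S.top .dst) 0 0).put (arr S.top .cnt) 0 0)
    (out := out) ?_
  · unfold loadRel
    refine (Run.set_seq (Run.set_seq (Run.seq (hloop.imp ?_) (T₂ := 25)))).le ?_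
    · rintro m' o ⟨rfl, h1, h2, h3, h4, h5⟩
      refine (run_simWrite h1 (by simp)).mono (by simp) ?_
      rintro m'' o ⟨rfl, q1, q2, q3⟩
      refine ⟨rfl, q2, h2.trans (q3.mono (regs_loadRegs_mono (by
        intro r hr; simp [loadRegs] at hr ⊢; tauto))), ?_⟩
      rw [q1, h3, eval_reg, h5]
      rfl
    · have : (D.rel i).length * (70 * S.arity i + 30 + 20) ≤
          (D.rel i).length * (100 * (S.arity i + 1)) := Nat.mul_le_mul_left _ (by omega)
      calc _ ≤ (D.rel i).length * (100 * (S.arity i + 1)) + 60 := by simp; omega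
        _ = _ := by ring
  · rintro l m' m'' o hF ⟨h1, h2, h3, h4, h5, h6⟩
    refine ⟨h1, h2.of_frame hF (by simp) (by simp), h3.trans (hF.mono ?_), ?_, ?_, ?_⟩
    · refine (Set.image_mono ?_).trans Set.subset_union_left
      intro r hr; simp [loadRegs] at hr ⊢; tauto
    · rw [simMem_eq_of_frame hF (by simp), h4]
    · rw [hF _ (by simp), h5]
    · rw [hF _ (by simp), h6]
  · rintro l m' o ⟨h1, h2, h3, -⟩
    exact hin.of_frame h3
  · rintro l t m' o ⟨rfl, h2, h3, h4, h5, h6⟩ ht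
    have hcol' : ∀ v, m' (arr S.top .color) (m' (arr S.top .dict) v) = col v := fun v => by
      rw [h3 _ (by simp [loadRegs]), h3 (arr S.top .dict) (by simp [loadRegs]), hcol]
    unfold loadTuple
    have hFb : Frame (regs S.top {.bad}) m' (m'.put (arr S.top .bad) 0 0) :=
      (Frame.refl _ _).put (by simp) _ _
    refine (Run.set_seq (Run.seq ((run_checks hi (req i) (t := t) (by simp) ?_).imp ?_)
      (T₂ := 40 * S.arity i + 20))).le ?_
    · intro j
      rw [eval_lit, ← ht j, hFb _ (notMem_regs_of_lt hi _), hFb (arr S.top .src) (by simp)]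
    · rintro m₁ o ⟨rfl, hF₁, hk⟩
      have hF : Frame (regs S.top {.bad}) m' m₁ := hFb.trans hF₁
      replace hk : m₁ (arr S.top .bad) 0 = 0 ↔ Keeps col (req i) t := by
        rw [hk]
        simp [hcol']
      have hc₁ := h2.of_frame hF (by simp) (by simp)
      have hs₁ : simMem S.top m₁ = simMem S.top m' := simMem_eq_of_frame hF (by simp)
      have hF₁' : Frame (regs S.top loadRegs ∪ simArrs S.top) m m₁ := h3.trans (hF.mono (by
        refine (Set.image_mono ?_).trans Set.subset_union_left
        intro r hr; simp [loadRegs] at hr ⊢; tauto))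
      refine (Run.cond (T := 40 * S.arity i + 10) (fun hb => ?_) (fun hb => ?_)).le
        (by simp; omega)
      · have hk' : ¬ Keeps col (req i) t := fun h => hb (hk.2 h)
        refine (Run.skip ⟨⟨rfl, hc₁, hF₁', ?_, ?_, ?_⟩, ?_, ?_⟩).le (by omega)
        · simp [hs₁, h4, List.filter_append, hk']
        · rw [hF _ (by simp), h5]; simp [List.filter_append, hk']
        · rw [hF _ (by simp), h6]; simp [List.filter_append, hk']
        · rw [hF _ (by simp)]
        · rw [hF _ (by simp)]
      · have hk' : Keeps col (req i) t := hk.1 hb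
        refine (Run.seq ((run_copy hi (r := S.arity i) (t := t) hc₁
          (l := (l.filter fun t => Keeps col (req i) t).flatMap List.ofFn) ?_ ?_ ?_).imp ?_)
          (T₂ := 6)).le (by omega)
        · rw [hs₁, h4]; simp
        · rw [hF _ (by simp), h5]
        · intro j
          rw [← ht j, hF _ (notMem_regs_of_lt hi _), hF (arr S.top .src) (by simp)]
        · rintro m₂ o ⟨rfl, q1, q2, q3, q4⟩
          have hF3 : Frame (regs S.top {.cnt}) m₂
              (m₂.put (arr S.top .cnt) 0 (m₂ (arr S.top .cnt) 0 + 1)) :=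
            (Frame.refl _ _).put (by simp) _ _
          refine (Run.set ⟨⟨rfl, ?_, ?_, ?_, ?_, ?_⟩, ?_, ?_⟩).le (by simp)
          · exact q1.of_frame hF3 (by simp) (by simp)
          · exact (hF₁'.trans (q2.mono (regs_loadRegs_mono (by
              intro r hr; simp [loadRegs] at hr ⊢; tauto)))).put (by simp [loadRegs]) _ _
          · refine (simMem_eq_of_frame (A := {.cnt}) hF3 (by simp)).trans ?_
            rw [q3, hs₁, h4]
            simp [List.filter_append, hk']
          · simp [q4, List.filter_append, hk']
          · simp [List.filter_append, hk']
            rw [q2 _ (by simp), hF _ (by simp), h6]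
          · simp
            rw [q2 _ (by simp), hF _ (by simp)]
          · simp
            rw [q2 _ (by simp), hF _ (by simp)]
    · simp; omega
  · have hF : Frame (regs S.top {.dst, .cnt}) m
        ((m.put (arr S.top .dst) 0 0).put (arr S.top .cnt) 0 0) :=
      ((Frame.refl _ _).put (by simp) _ _).put (by simp) _ _
    refine ⟨rfl, hc.of_frame hF (by simp) (by simp), hF.mono ?_, ?_, by simp, by simp⟩
    · refine (Set.image_mono ?_).trans Set.subset_union_left
      intro r hr; simp [loadRegs] at hr ⊢; tauto
    · rw [simMem_eq_of_frame hF (by simp)]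
      have : simMem S.top m (i + 1) = fun _ => 0 := funext h0
      simp [← this]

theorem run_loadAll {S : Schema} (D : Database S) (col : ℕ → ℕ)
    (req : (i : Fin S.numRel) → Fin (S.arity i) → Option ℕ) {m : Memory}
    {out : List (List ℕ)} (hin : InputOk D m) (hc : Capped S.top m)
    (hcol : ∀ v, m (arr S.top .color) (m (arr S.top .dict) v) = col v) :
    Run (loadAll S req) m out (260 * D.size + 10) fun m' o =>
      o = out ∧ Capped S.top m' ∧ simMem S.top m' = (D.restrict col req).initMem ∧
      Frame (regs S.top (insert .base loadRegs) ∪ simArrs S.top) m m' := by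
  unfold loadAll
  have hA : regs S.top loadRegs ∪ simArrs S.top ⊆
      regs S.top (insert .base loadRegs) ∪ simArrs S.top :=
    Set.union_subset_union_left _ (Set.image_mono (Set.subset_insert _ _))
  set m₁ := m.put (arr S.top .base) 0 (m (arr S.top .high) 0) with hm₁
  have hF₁ : Frame (regs S.top (insert .base loadRegs) ∪ simArrs S.top) m m₁ :=
    (Frame.refl _ _).put (by simp) _ _
  -- After `base := high` no cell exceeds the base, and truncated subtraction reads every cell as
  -- `0`.
  have h0 : ∀ a j, simMem S.top m₁ a j = 0 := fun a j => by
    have := hc.2 a j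
    simp [simMem, hm₁, this]
  have hc₁ : Capped S.top m₁ := ⟨by simp [hm₁], by simpa [hm₁] using hc.2⟩
  refine (Run.set_seq ((Run.seqAll _ (fun l m' o => o = out ∧ Capped S.top m' ∧
    Frame (regs S.top (insert .base loadRegs) ∪ simArrs S.top) m m' ∧
    (∀ i : Fin S.numRel, i ∈ l → (∀ j, simMem S.top m' (i + 1) j = ((D.restrict col req).cells i).getD j 0) ∧
      simMem S.top m' 0 i = ((D.restrict col req).rel i).length) ∧
    (∀ a, (∀ i : Fin S.numRel, i ∈ l → a ≠ (i : ℕ)) → ∀ j, simMem S.top m' (a + 1) j = 0) ∧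
    (∀ a, (∀ i : Fin S.numRel, i ∈ l → a ≠ (i : ℕ)) → simMem S.top m' 0 a = 0))
    (fun i => 100 * ((D.rel i).length * (S.arity i + 1)) + 60) (List.finRange S.numRel) ?_ ?_).mono
    (add_le_add_left (sum_relation_cost_le D _ _) 1) ?_)).le (by simp; omega)
  · rintro pre i post hl m' o ⟨rfl, h1, h2, h3, h4, h5⟩
    have hnd : i ∉ pre := by
      have := List.nodup_finRange S.numRel
      rw [hl] at this
      intro hmem
      exact (List.nodup_append.1 this).2.2 _ hmem i (by simp) rfl
    have hne : ∀ i' ∈ pre, (i : ℕ) ≠ i' := fun i' hi' he => hnd (by rwa [Fin.ext he])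
    refine (run_loadRel D col req i (hin.of_frame h2) h1 (h4 i hne) ?_).imp ?_
    · intro v
      rw [h2 _ (by simp [loadRegs]), h2 (arr S.top .dict) (by simp [loadRegs]), hcol]
    · rintro m'' o ⟨rfl, q1, q2, q3⟩
      refine ⟨rfl, q1, h2.trans (q2.mono hA), ?_, ?_, ?_⟩
      · intro i' hi'
        by_cases hii : i' = i
        · subst hii
          simp [q3]
        · have hi'' : i' ∈ pre := by simpa [hii] using hi'
          have hv : (i' : ℕ) ≠ i := fun he => hii (Fin.ext he)
          simp [q3, hv, h3 i' hi'']
      · intro a ha j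
        have h6 : a ≠ i := ha i (by simp)
        simp [q3, h6, h4 a (fun i' hi' => ha i' (by simp [hi']))]
      · intro a ha
        have h6 : a ≠ i := ha i (by simp)
        simp [q3, h6, h5 a (fun i' hi' => ha i' (by simp [hi']))]
  · exact ⟨rfl, hc₁, hF₁, by simp, fun a _ j => h0 _ _, fun a _ => h0 _ _⟩
  · rintro m' o ⟨h1, h2, h3, h4, h5, h6⟩
    refine ⟨h1, h2, ?_, h3⟩
    funext a j
    cases a with
    | zero =>
      by_cases hj : j < S.numRel
      · simpa [Database.initMem, hj] using (h4 ⟨j, hj⟩ (by simp)).2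
      · simpa [Database.initMem, hj] using h6 j (fun i _ he => hj (he ▸ i.2))
    | succ a =>
      by_cases ha : a < S.numRel
      · simpa [Database.initMem, ha] using (h4 ⟨a, ha⟩ (by simp)).1 j
      · simpa [Database.initMem, ha] using h5 a (fun i _ he => ha (he ▸ i.2)) j


/-! ### Linear colourings -/

/-- The colouring `f` of the numbers below `2 ^ l` by numbers below `K` is linear in the binary
digits. -/
structure IsLinear (l K : ℕ) (f : ℕ → ℕ) : Prop where
  zero : f 0 = 0
  lt : ∀ x < 2 ^ l, f x < K
  step : ∀ i < l, ∃ a, ∀ r < 2 ^ i, f (2 ^ i + r) = a ^^^ f r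

/-- No carry occurs, as bit `i` of `r` is `0`. -/
theorem two_pow_add_eq_xor {i r : ℕ} (h : r < 2 ^ i) : 2 ^ i + r = 2 ^ i ^^^ r := by
  have h1 : 2 ^ i + r = 2 ^ i ||| r := by simpa using Nat.two_pow_add_eq_or_of_lt h 1
  rw [h1]
  apply Nat.eq_of_testBit_eq
  intro j
  rw [Nat.testBit_or, Nat.testBit_xor, Nat.testBit_two_pow]
  by_cases hj : i = j
  · subst hj
    simp [Nat.testBit_eq_false_of_lt h]
  · simp [hj]

/-- Induction on the number of bits: split off the leading bit of each argument, whose image is `a`.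
If both leading bits are set, they cancel, and so do the two copies of `a`. -/
theorem IsLinear.xor {l K : ℕ} {f : ℕ → ℕ} (h : IsLinear l K f) {x y : ℕ} (hx : x < 2 ^ l)
    (hy : y < 2 ^ l) : f (x ^^^ y) = f x ^^^ f y := by
  suffices H : ∀ i ≤ l, ∀ x < 2 ^ i, ∀ y < 2 ^ i, f (x ^^^ y) = f x ^^^ f y from
    H l le_rfl x hx y hy
  intro i
  induction i with
  | zero =>
    intro _ x hx y hy
    have h1 : x = 0 := by simpa using hx
    have h2 : y = 0 := by simpa using hy
    simp [h1, h2, h.zero]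
  | succ i ih =>
    intro hi x hx y hy
    obtain ⟨a, ha⟩ := h.step i hi
    have ih := ih (by omega)
    have split : ∀ z < 2 ^ (i + 1), z < 2 ^ i ∨ ∃ r < 2 ^ i, z = 2 ^ i ^^^ r := by
      intro z hz
      rw [pow_succ] at hz
      rcases lt_or_ge z (2 ^ i) with h | h
      · exact Or.inl h
      · refine Or.inr ⟨z - 2 ^ i, by omega, ?_⟩
        rw [← two_pow_add_eq_xor (by omega)]
        omega
    have ha' : ∀ r < 2 ^ i, f (2 ^ i ^^^ r) = a ^^^ f r := fun r hr => by
      rw [← two_pow_add_eq_xor hr, ha r hr]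
    rcases split x hx with hx | ⟨r, hr, rfl⟩ <;> rcases split y hy with hy | ⟨r', hr', rfl⟩
    · exact ih x hx y hy
    · rw [ha' r' hr', Nat.xor_left_comm, ha' _ (Nat.xor_lt_two_pow hx hr'), ih x hx r' hr',
        Nat.xor_left_comm]
    · rw [ha' r hr, Nat.xor_assoc, ha' _ (Nat.xor_lt_two_pow hr hy), ih r hr y hy, Nat.xor_assoc]
    · rw [ha' r hr, ha' r' hr']
      have h1 : ∀ a b c : ℕ, (a ^^^ b) ^^^ (a ^^^ c) = b ^^^ c := fun a b c => by
        rw [Nat.xor_assoc, Nat.xor_left_comm b a c, ← Nat.xor_assoc, Nat.xor_self, Nat.zero_xor]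
      rw [h1, h1, ih r hr r' hr']

/-! ### Choosing colourings by conditional expectations

The weight of a number `x` is `w x + 1`. A colouring is chosen bit by bit so that the total weight
of the nonzero numbers of colour `0` is at most the average, and their weights are doubled. -/

/-- The colouring `f` is balanced for the weights `w`, and `w'` are the new weights. -/
structure IsRound (l K : ℕ) (w f w' : ℕ → ℕ) : Prop where
  zero : f 0 = 0
  lt : ∀ x < 2 ^ l, f x < K
  step : ∀ i < l, ∃ a, (∀ r < 2 ^ i, f (2 ^ i + r) = a ^^^ f r) ∧
    K * ∑ r ∈ Finset.range (2 ^ i), (if f r = a then w (2 ^ i + r) + 1 else 0) ≤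
      ∑ r ∈ Finset.range (2 ^ i), (w (2 ^ i + r) + 1)
  weight : ∀ x, 0 < x → x < 2 ^ l → w' x = if f x = 0 then 2 * w x + 1 else w x

theorem IsRound.isLinear {l K : ℕ} {w f w' : ℕ → ℕ} (h : IsRound l K w f w') : IsLinear l K f :=
  ⟨h.zero, h.lt, fun i hi => (h.step i hi).imp fun _ => And.left⟩

/-- The nonzero numbers fall into dyadic blocks according to their leading bit, and the image of
that bit is what is chosen for the block. -/
theorem sum_Ico_two_pow_succ (F : ℕ → ℕ) (i : ℕ) :
    ∑ x ∈ Finset.Ico 1 (2 ^ (i + 1)), F x =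
      ∑ x ∈ Finset.Ico 1 (2 ^ i), F x + ∑ r ∈ Finset.range (2 ^ i), F (2 ^ i + r) := by
  rw [← Finset.sum_Ico_consecutive F Nat.one_le_two_pow
    (Nat.pow_le_pow_right two_pos (Nat.le_succ i)), Finset.sum_Ico_eq_sum_range F (2 ^ i)]
  congr 2
  rw [pow_succ]; congr 1; omega

/-- In each block the gain in weight is exactly the weight of the numbers coloured `0`, at most a
fraction `1 / K` of the block; the blocks are added up. -/
theorem IsRound.sum_le {l K : ℕ} {w f w' : ℕ → ℕ} (h : IsRound l K w f w') :
    K * ∑ x ∈ Finset.Ico 1 (2 ^ l), (w' x + 1) ≤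
      (K + 1) * ∑ x ∈ Finset.Ico 1 (2 ^ l), (w x + 1) := by
  suffices H : ∀ i ≤ l, K * ∑ x ∈ Finset.Ico 1 (2 ^ i), (w' x + 1) ≤
      (K + 1) * ∑ x ∈ Finset.Ico 1 (2 ^ i), (w x + 1) from H l le_rfl
  intro i
  induction i with
  | zero => simp
  | succ i ih =>
    intro hi
    have ih := ih (by omega)
    obtain ⟨a, ha, hle⟩ := h.step i hi
    have heq : ∑ r ∈ Finset.range (2 ^ i), (w' (2 ^ i + r) + 1) =
        ∑ r ∈ Finset.range (2 ^ i), (w (2 ^ i + r) + 1) +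
        ∑ r ∈ Finset.range (2 ^ i), (if f r = a then w (2 ^ i + r) + 1 else 0) := by
      rw [← Finset.sum_add_distrib]
      refine Finset.sum_congr rfl fun r hr => ?_
      have hr : r < 2 ^ i := Finset.mem_range.1 hr
      have hlt : 2 ^ i + r < 2 ^ l := by
        have := Nat.pow_le_pow_right two_pos hi
        rw [Nat.pow_succ] at this
        omega
      have hpos : 0 < 2 ^ i := by positivity
      rw [h.weight _ (by omega) hlt, ha r hr]
      -- So the numbers whose weight doubles are those counted by the balance condition in
      -- `IsRound.step`.
      have : a ^^^ f r = 0 ↔ f r = a := by rw [Nat.xor_eq_zero_iff, eq_comm]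
      simp only [this]
      split_ifs <;> ring
    rw [sum_Ico_two_pow_succ, sum_Ico_two_pow_succ, heq]
    nlinarith

/-- The colourings `fs` are linear, and `w` are the weights after the rounds that have chosen
them. -/
structure IsHistory (l K : ℕ) (fs : List (ℕ → ℕ)) (w : ℕ → ℕ) : Prop where
  linear : ∀ f ∈ fs, IsLinear l K f
  weight : ∀ x, 0 < x → x < 2 ^ l → w x + 1 = 2 ^ fs.countP (fun f => f x = 0)
  sum_le : K ^ fs.length * ∑ x ∈ Finset.Ico 1 (2 ^ l), (w x + 1) ≤ (K + 1) ^ fs.length * 2 ^ l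

theorem IsHistory.nil (l K : ℕ) {w : ℕ → ℕ} (hw : ∀ x, w x = 0) : IsHistory l K [] w where
  linear := by simp
  weight := by simp [hw]
  sum_le := by simp [hw]

theorem IsHistory.cons {l K : ℕ} {fs : List (ℕ → ℕ)} {w f w' : ℕ → ℕ} (h : IsHistory l K fs w)
    (hf : IsRound l K w f w') : IsHistory l K (f :: fs) w' where
  linear g hg := by
    rcases List.mem_cons.1 hg with rfl | hg
    · exact hf.isLinear
    · exact h.linear g hg
  weight x hx hxl := by
    have := h.weight x hx hxl
    rw [hf.weight x hx hxl, List.countP_cons]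
    by_cases h0 : f x = 0
    · simp only [h0, if_true, decide_true, pow_succ, ← this]; ring
    · simp [h0, this]
  sum_le := by
    have h1 := hf.sum_le
    have h2 := h.sum_le
    rw [List.length_cons, pow_succ, pow_succ, mul_assoc]
    calc _ ≤ K ^ fs.length * ((K + 1) * ∑ x ∈ Finset.Ico 1 (2 ^ l), (w x + 1)) :=
          Nat.mul_le_mul_left _ h1
      _ = (K + 1) * (K ^ fs.length * ∑ x ∈ Finset.Ico 1 (2 ^ l), (w x + 1)) := by ring
      _ ≤ (K + 1) * ((K + 1) ^ fs.length * 2 ^ l) := Nat.mul_le_mul_left _ h2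
      _ = _ := by ring

/-! ### From the bound on the weights to separation. -/

/-- This is `(1 + 1 / K) ^ K ≤ e`, with `e` rounded up to a power of two. -/
theorem succ_pow_self_le (K : ℕ) : (K + 1) ^ K ≤ 4 * K ^ K := by
  rcases Nat.eq_zero_or_pos K with rfl | hK
  · simp
  have hK' : (0 : ℝ) < K := by exact_mod_cast hK
  have h1 : (1 / (K : ℝ) + 1) ^ K ≤ 4 := by
    calc (1 / (K : ℝ) + 1) ^ K ≤ (Real.exp (1 / K)) ^ K :=
          pow_le_pow_left₀ (by positivity) (Real.add_one_le_exp _) _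
      _ = Real.exp 1 := by rw [← Real.exp_nat_mul]; congr 1; field_simp
      _ ≤ 4 := by have := Real.exp_one_lt_d9; linarith
  have h2 : ((K : ℝ) + 1) ^ K = (1 / (K : ℝ) + 1) ^ K * (K : ℝ) ^ K := by
    rw [← mul_pow]; congr 1; field_simp; ring
  have h3 : ((K : ℝ) + 1) ^ K ≤ 4 * (K : ℝ) ^ K := by
    rw [h2]; exact mul_le_mul_of_nonneg_right h1 (by positivity)
  exact_mod_cast h3

/-- After `K * (l + 1)` rounds, few of the colourings give colour `0` to a nonzero number. -/
theorem IsHistory.countP_le {l K : ℕ} (hK : 0 < K) {fs : List (ℕ → ℕ)} {w : ℕ → ℕ}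
    (h : IsHistory l K fs w) (hlen : fs.length = K * (l + 1)) {x : ℕ} (hx : 0 < x)
    (hxl : x < 2 ^ l) : fs.countP (fun f => f x = 0) ≤ 3 * l + 2 := by
  have h1 : 2 ^ fs.countP (fun f => f x = 0) ≤ ∑ x ∈ Finset.Ico 1 (2 ^ l), (w x + 1) := by
    rw [← h.weight x hx hxl]
    exact Finset.single_le_sum (f := fun x => w x + 1) (fun _ _ => Nat.zero_le _)
      (Finset.mem_Ico.2 ⟨hx, hxl⟩)
  -- Each `K` rounds multiply the total weight by at most `4`. Starting from at most `2 ^ l`, it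
  -- ends at no more than `2 ^ (2 * (l + 1) + l)`, whence the exponent `3 * l + 2`.
  have h2 : (K + 1) ^ fs.length ≤ 2 ^ (2 * (l + 1)) * K ^ fs.length := by
    rw [hlen, pow_mul, pow_mul, pow_mul, ← mul_pow]
    exact Nat.pow_le_pow_left (succ_pow_self_le K) _
  have h3 : K ^ fs.length * 2 ^ fs.countP (fun f => f x = 0) ≤
      K ^ fs.length * 2 ^ (3 * l + 2) :=
    calc _ ≤ _ := Nat.mul_le_mul_left _ h1
      _ ≤ _ := h.sum_le
      _ ≤ 2 ^ (2 * (l + 1)) * K ^ fs.length * 2 ^ l := Nat.mul_le_mul_right _ h2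
      _ = _ := by ring
  exact (Nat.pow_le_pow_iff_right one_lt_two).1
    (Nat.le_of_mul_le_mul_left h3 (Nat.pow_pos hK))

/-- Some of the colourings separates all the given pairs of numbers. -/
theorem IsHistory.exists_separating {l K : ℕ} (hK : 0 < K) {fs : List (ℕ → ℕ)} {w : ℕ → ℕ}
    (h : IsHistory l K fs w) (hlen : fs.length = K * (l + 1)) {ι : Type*} (E : Finset ι)
    (x y : ι → ℕ) (hE : 4 * E.card ≤ K) (hx : ∀ e ∈ E, x e < 2 ^ l) (hy : ∀ e ∈ E, y e < 2 ^ l)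
    (hne : ∀ e ∈ E, x e ≠ y e) : ∃ f ∈ fs, ∀ e ∈ E, f (x e) ≠ f (y e) := by
  by_contra! hcon
  have h1 : ∀ f ∈ fs, ∃ e ∈ E, f (x e ^^^ y e) = 0 := by
    intro f hf
    obtain ⟨e, he, heq⟩ := hcon f hf
    exact ⟨e, he, by rw [(h.linear f hf).xor (hx e he) (hy e he), heq, Nat.xor_self]⟩
  -- Union bound: if every round fails on some pair, the failures summed over the pairs are at least
  -- as many as the rounds.
  have h2 : ∀ l : List (ℕ → ℕ), (∀ f ∈ l, ∃ e ∈ E, f (x e ^^^ y e) = 0) →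
      l.length ≤ ∑ e ∈ E, l.countP (fun f => f (x e ^^^ y e) = 0) := by
    intro l hl
    induction l with
    | nil => simp
    | cons f l ih =>
      obtain ⟨e, he, h0⟩ := hl f (by simp)
      have h3 := ih fun g hg => hl g (by simp [hg])
      have h4 : 1 ≤ ∑ e ∈ E, (if f (x e ^^^ y e) = 0 then 1 else 0) := by
        refine le_trans ?_ (Finset.single_le_sum
          (f := fun e => if f (x e ^^^ y e) = 0 then 1 else 0) (fun _ _ => Nat.zero_le _) he)
        simp [h0]
      simp only [List.countP_cons, Finset.sum_add_distrib, List.length_cons, decide_eq_true_eq]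
      omega
  have h3 := (h2 fs h1).trans (Finset.sum_le_card_nsmul E _ (3 * l + 2) fun e he => by
    refine h.countP_le hK hlen (Nat.pos_of_ne_zero fun h0 => hne e he ?_)
      (Nat.xor_lt_two_pow (hx e he) (hy e he))
    exact Nat.xor_eq_zero_iff.1 h0)
  rw [hlen, smul_eq_mul] at h3
  -- The contradiction: `4 * K * (l + 1) ≤ 4 * E.card * (3 * l + 2) ≤ 3 * K * (l + 1)`.
  have h4 : 4 * E.card * (l + 1) ≤ K * (l + 1) := Nat.mul_le_mul_right _ hE
  have h5 : 0 < K * (l + 1) := by positivity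
  nlinarith

/-! ### The program that chooses a colouring -/

/-- Add up the weights of the numbers `pow + r` for every colour of `r`. -/
def tallyLoop (g : ℕ) : Prog :=
  .loop (.sub (.reg g .pow) (.reg g .idx))
    (.seq (.write (arr g .tally) (.get g .color (.reg g .idx))
        (.add (.get g .tally (.get g .color (.reg g .idx)))
          (.add (.get g .weight (.add (.reg g .pow) (.reg g .idx))) (.lit 1))))
      (.set g .idx (.add (.reg g .idx) (.lit 1))))

/-- The entry `a` of the tally is the weight that would receive colour `0` in the block from `n` on
if `a` were chosen as the image of its leading bit. -/
theorem run_tallyLoop {g : ℕ} {m : Memory} {out : List (List ℕ)} {n : ℕ}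
    (hpow : m (arr g .pow) 0 = n) (hidx : m (arr g .idx) 0 = 0)
    (K : ℕ) (ht : ∀ a < K, m (arr g .tally) a = 0) :
    Run (tallyLoop g) m out (40 * n + 10) fun m' o => o = out ∧
      Frame (regs g {.tally, .idx}) m m' ∧ ∀ a < K, m' (arr g .tally) a =
        ∑ r ∈ Finset.range n,
          (if m (arr g .color) r = a then m (arr g .weight) (n + r) + 1 else 0) := by
  refine (Run.loop (fun j m' o => o = out ∧ Frame (regs g {.tally, .idx}) m m' ∧ j ≤ n ∧
    m' (arr g .idx) 0 = n - j ∧ ∀ a < K, m' (arr g .tally) a = ∑ r ∈ Finset.range (n - j),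
      (if m (arr g .color) r = a then m (arr g .weight) (n + r) + 1 else 0)) (fun _ => 30)
      ?_ ?_ n m out ?_).mono ?_ ?_
  · rintro m' o ⟨rfl, hF, -, hi, -⟩
    simp [hi, hF (arr g .pow) (by simp), hpow]
  · rintro j m' o ⟨rfl, hF, hj, hi, ht'⟩
    have hp : m' (arr g .pow) 0 = n := by rw [hF _ (by simp), hpow]
    have hc : m' (arr g .color) = m (arr g .color) := hF _ (by simp)
    have hw : m' (arr g .weight) = m (arr g .weight) := hF _ (by simp)
    refine ⟨by simp [hp, hi]; omega, (Run.put_seq (Run.set ⟨rfl, ?_, by omega, ?_, ?_⟩)).le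
      (by simp)⟩
    · exact (hF.put (by simp) _ _).put (by simp) _ _
    · simp [hi]; omega
    · intro a ha
      rw [show n - j = n - (j + 1) + 1 by omega, Finset.sum_range_succ, ← ht' a ha]
      by_cases hca : m (arr g .color) (n - (j + 1)) = a
      · simp [hc, hw, hi, hca, hp]
      · simp [hc, hi, hca, Ne.symm hca]
  · exact ⟨rfl, Frame.refl _ _, le_rfl, by simp [hidx], by simpa using ht⟩
  · simp; omega
  · rintro m' o ⟨h1, h2, -, -, h3⟩
    exact ⟨h1, h2, by simpa using h3⟩

/-- Find a colour of least weight. -/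
def argmin (g K : ℕ) : Prog :=
  .seq (.set g .best (.get g .tally (.lit 0)))
    (.seq (.set g .arg (.lit 0))
      (seqAll ((List.range K).map fun a =>
        .cond (.sub (.reg g .best) (.get g .tally (.lit a)))
          (.seq (.set g .best (.get g .tally (.lit a))) (.set g .arg (.lit (a * K)))) .skip)))

/-- The register `arg` holds `a * K` instead of `a`: it is the offset of row `a` in the table of the
exclusive or, and the machine cannot multiply. -/
theorem run_argmin {g K : ℕ} (hK : 0 < K) {m : Memory} {out : List (List ℕ)} :
    Run (argmin g K) m out (20 * K + 20) fun m' o => o = out ∧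
      Frame (regs g {.best, .arg}) m m' ∧ ∃ a < K, m' (arr g .arg) 0 = a * K ∧
        ∀ b < K, m (arr g .tally) a ≤ m (arr g .tally) b := by
  unfold argmin
  refine (Run.set_seq (Run.set_seq ((Run.seqAll _ (fun pre m' o => o = out ∧
    Frame (regs g {.best, .arg}) m m' ∧ ∃ a < K, m' (arr g .arg) 0 = a * K ∧
      m' (arr g .best) 0 = m (arr g .tally) a ∧
      ∀ b ∈ pre, m (arr g .tally) a ≤ m (arr g .tally) b) (fun _ => 20) (List.range K) ?_ ?_).imp
      ?_))).le ?_
  · rintro pre b post hl m' o ⟨rfl, hF, a, ha, h1, h2, h3⟩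
    have hb : b < K := List.mem_range.1 (by rw [hl]; simp)
    have ht : m' (arr g .tally) = m (arr g .tally) := hF _ (by simp)
    refine (Run.cond (T := 9) (fun hc => ?_) (fun hc => ?_)).le (by simp)
    · simp only [eval_sub, eval_reg, eval_get, eval_lit, ht, h2] at hc
      refine (Run.set_seq (Run.set ⟨rfl, ?_, b, hb, by simp, by simp [ht], ?_⟩)).le (by simp)
      · exact (hF.put (by simp) _ _).put (by simp) _ _
      · intro d hd
        rcases List.mem_append.1 hd with hd | hd
        · have := h3 d hd; omega
        · rw [List.mem_singleton.1 hd]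
    · simp only [eval_sub, eval_reg, eval_get, eval_lit, ht, h2] at hc
      refine (Run.skip ⟨rfl, hF, a, ha, h1, h2, ?_⟩).le (by omega)
      intro d hd
      rcases List.mem_append.1 hd with hd | hd
      · exact h3 d hd
      · rw [List.mem_singleton.1 hd]; omega
  · exact ⟨rfl, ((Frame.refl _ _).put (by simp) _ _).put (by simp) _ _, 0, hK, by simp, by simp,
      by simp⟩
  · rintro m' o ⟨h1, h2, a, h3, h4, -, h5⟩
    exact ⟨h1, h2, a, h3, h4, fun b hb => h5 b (by simpa using hb)⟩
  · simp; omega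

/-- Colour the numbers from `pow` to `2 * pow`, and double the weights of those of colour `0`. -/
def extendLoop (g : ℕ) : Prog :=
  .loop (.sub (.reg g .pow) (.reg g .idx))
    (.seq (.write (arr g .color) (.add (.reg g .pow) (.reg g .idx))
        (.get g .table (.add (.reg g .arg) (.get g .color (.reg g .idx)))))
      (.seq (.cond (.get g .color (.add (.reg g .pow) (.reg g .idx))) .skip
          (.write (arr g .weight) (.add (.reg g .pow) (.reg g .idx))
            (.add (.add (.get g .weight (.add (.reg g .pow) (.reg g .idx)))
              (.get g .weight (.add (.reg g .pow) (.reg g .idx)))) (.lit 1))))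
        (.set g .idx (.add (.reg g .idx) (.lit 1)))))

theorem run_extendLoop {g K a n : ℕ} {m : Memory} {out : List (List ℕ)}
    (hpow : m (arr g .pow) 0 = n) (hidx : m (arr g .idx) 0 = 0)
    (harg : m (arr g .arg) 0 = a * K)
    (htab : ∀ u < K, m (arr g .table) (a * K + u) = a ^^^ u)
    (hcol : ∀ r < n, m (arr g .color) r < K) :
    Run (extendLoop g) m out (60 * n + 10) fun m' o => o = out ∧
      Frame (regs g {.color, .weight, .idx}) m m' ∧
      (∀ x, m' (arr g .color) x = if n ≤ x ∧ x < n + n then a ^^^ m (arr g .color) (x - n)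
        else m (arr g .color) x) ∧
      ∀ x, m' (arr g .weight) x =
        if n ≤ x ∧ x < n + n ∧ a ^^^ m (arr g .color) (x - n) = 0 then
          2 * m (arr g .weight) x + 1 else m (arr g .weight) x := by
  refine (Run.loop (fun j m' o => o = out ∧ Frame (regs g {.color, .weight, .idx}) m m' ∧ j ≤ n ∧
    m' (arr g .idx) 0 = n - j ∧
      (∀ x, m' (arr g .color) x = if n ≤ x ∧ x < n + (n - j) then a ^^^ m (arr g .color) (x - n)
        else m (arr g .color) x) ∧
      ∀ x, m' (arr g .weight) x =
        if n ≤ x ∧ x < n + (n - j) ∧ a ^^^ m (arr g .color) (x - n) = 0 then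
          2 * m (arr g .weight) x + 1 else m (arr g .weight) x) (fun _ => 54)
      ?_ ?_ n m out ?_).mono ?_ ?_
  · rintro m' o ⟨rfl, hF, -, hi, -⟩
    simp [hi, hF (arr g .pow) (by simp), hpow]
  · rintro j m' o ⟨rfl, hF, hj, hi, hc, hw⟩
    have hp : m' (arr g .pow) 0 = n := by rw [hF _ (by simp), hpow]
    have hr : n - (j + 1) < n := by omega
    have hval : m' (arr g .table) (m' (arr g .arg) 0 + m' (arr g .color) (n - (j + 1))) =
        a ^^^ m (arr g .color) (n - (j + 1)) := by
      rw [hF _ (by simp), hF (arr g .arg) (by simp), harg, hc, if_neg (by omega),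
        htab _ (hcol _ hr)]
    have hx : n + (n - (j + 1)) - n = n - (j + 1) := by omega
    have hc' : ∀ x, Function.update (m' (arr g .color)) (n + (n - (j + 1)))
        (a ^^^ m (arr g .color) (n - (j + 1))) x =
        if n ≤ x ∧ x < n + (n - j) then a ^^^ m (arr g .color) (x - n)
        else m (arr g .color) x := by
      intro x
      by_cases hxx : x = n + (n - (j + 1))
      · rw [hxx, Function.update_self, if_pos (by omega), hx]
      · rw [Function.update_of_ne hxx, hc]
        have : (n ≤ x ∧ x < n + (n - (j + 1))) ↔ (n ≤ x ∧ x < n + (n - j)) := by omega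
        simp only [this]
    refine ⟨by simp [hp, hi]; omega, (Run.put_seq (Run.seq (Run.cond (T := 24) (fun h0 => ?_)
      (fun h0 => ?_)) (T₂ := 6))).le (by simp)⟩
    · refine (Run.skip ((Run.set ⟨rfl, ?_, by omega, ?_, ?_, ?_⟩).le (by simp))).le (by simp)
      · exact (hF.put (by simp) _ _).put (by simp) _ _
      · simp [hi]; omega
      · simpa [hp, hi, hval] using hc'
      · have h0' : a ^^^ m (arr g .color) (n - (j + 1)) ≠ 0 := by
          simpa only [eval_get, eval_add, eval_reg, hp, hi, hval, Memory.put_same, Memory.put_ne,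
            ne_eq, arr_inj, reduceCtorEq, not_false_eq_true, Function.update_self] using h0
        intro x
        have : (n ≤ x ∧ x < n + (n - j) ∧ a ^^^ m (arr g .color) (x - n) = 0) ↔
            (n ≤ x ∧ x < n + (n - (j + 1)) ∧ a ^^^ m (arr g .color) (x - n) = 0) := by
          refine and_congr_right fun h1 => and_congr_left fun h2 => ?_
          have : x - n ≠ n - (j + 1) := fun he => h0' (he ▸ h2)
          omega
        simp only [this, Memory.put_ne, ne_eq, arr_inj, reduceCtorEq, not_false_eq_true]
        exact hw x
    · refine (Run.put ((Run.set ⟨rfl, ?_, by omega, ?_, ?_, ?_⟩).le (by simp))).le (by simp)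
      · exact ((hF.put (by simp) _ _).put (by simp) _ _).put (by simp) _ _
      · simp [hi]; omega
      · simpa [hp, hi, hval] using hc'
      · have h0' : a ^^^ m (arr g .color) (n - (j + 1)) = 0 := by
          simpa only [eval_get, eval_add, eval_reg, hp, hi, hval, Memory.put_same, Memory.put_ne,
            ne_eq, arr_inj, reduceCtorEq, not_false_eq_true, Function.update_self] using h0
        intro x
        simp only [eval_get, eval_add, eval_reg, eval_lit, hp, hi, Memory.put_same, Memory.put_ne,
          ne_eq, arr_inj, reduceCtorEq, not_false_eq_true]
        by_cases hxx : x = n + (n - (j + 1))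
        · rw [hxx, Function.update_self, if_pos ⟨by omega, by omega, by rw [hx, h0']⟩, hw,
            if_neg (by omega)]
          ring
        · rw [Function.update_of_ne hxx, hw]
          have : (n ≤ x ∧ x < n + (n - (j + 1)) ∧ a ^^^ m (arr g .color) (x - n) = 0) ↔
              (n ≤ x ∧ x < n + (n - j) ∧ a ^^^ m (arr g .color) (x - n) = 0) := by
            refine and_congr_right fun h1 => and_congr_left fun h2 => ?_
            omega
          simp only [this]
  · refine ⟨rfl, Frame.refl _ _, le_rfl, by simp [hidx], fun x => ?_, fun x => ?_⟩
    · rw [if_neg (by omega)]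
    · rw [if_neg (by omega)]
  · simp; omega
  · rintro m' o ⟨h1, h2, -, -, h3, h4⟩
    exact ⟨h1, h2, h3, h4⟩

/-- Choose the colours of the numbers from `pow` to `2 * pow`. -/
def extend (g K : ℕ) : Prog :=
  .seq (seqAll ((List.range K).map fun a => .write (arr g .tally) (.lit a) (.lit 0)))
    (.seq (.set g .idx (.lit 0))
      (.seq (tallyLoop g)
        (.seq (argmin g K)
          (.seq (.set g .idx (.lit 0))
            (.seq (extendLoop g)
              (.set g .pow (.add (.reg g .pow) (.reg g .pow))))))))

/-- The registers that the choice of a colouring modifies. -/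
def roundRegs : Set Reg := {.color, .weight, .idx, .tally, .best, .arg, .pow}

/-- The table of the exclusive or. -/
def TableOk (g K : ℕ) (m : Memory) : Prop :=
  ∀ a < K, ∀ u < K, m (arr g .table) (a * K + u) = a ^^^ u

/-- A round on `i` bits extends to `i + 1` bits. Colours and weights below `2 ^ i` stay as they are,
and weights from `2 ^ i` on are still the old ones when they are tallied. -/
theorem run_extend {g s i : ℕ} {m : Memory} {out : List (List ℕ)} {w : ℕ → ℕ}
    (htab : TableOk g (2 ^ s) m) (hpow : m (arr g .pow) 0 = 2 ^ i)
    (hr : IsRound i (2 ^ s) w (m (arr g .color)) (m (arr g .weight)))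
    (hw : ∀ x, 2 ^ i ≤ x → m (arr g .weight) x = w x) :
    Run (extend g (2 ^ s)) m out (100 * 2 ^ i + 30 * 2 ^ s + 70) fun m' o => o = out ∧
      Frame (regs g roundRegs) m m' ∧ m' (arr g .pow) 0 = 2 ^ (i + 1) ∧
      IsRound (i + 1) (2 ^ s) w (m' (arr g .color)) (m' (arr g .weight)) ∧
      ∀ x, 2 ^ (i + 1) ≤ x → m' (arr g .weight) x = w x := by
  set K := 2 ^ s with hK
  have hKpos : 0 < K := by positivity
  unfold extend
  refine (Run.seq ((Run.seqAll _ (fun pre m' o => o = out ∧ Frame (regs g {.tally}) m m' ∧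
    ∀ a ∈ pre, m' (arr g .tally) a = 0) (fun _ => 3) (List.range K) ?_ ?_).imp ?_)
    (T₂ := 100 * 2 ^ i + 20 * K + 69)).le ?_
  · rintro pre a post - m' o ⟨rfl, hF, h0⟩
    refine (Run.put ⟨rfl, hF.put (by simp) _ _, ?_⟩).le (by simp)
    intro b hb
    by_cases hba : b = a
    · simp [hba]
    · have : b ∈ pre := by simpa [hba] using hb
      simp [hba, h0 b this]
  · exact ⟨rfl, Frame.refl _ _, by simp⟩
  swap
  · simp; omega
  rintro m₁ o ⟨rfl, hF₁, ht₁⟩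
  refine (Run.set_seq (Run.seq ((run_tallyLoop (n := 2 ^ i) ?_ (by simp) K ?_).imp ?_)
    (T₂ := 60 * 2 ^ i + 20 * K + 56))).le (by simp; omega)
  · simp [hF₁ (arr g .pow) (by simp), hpow]
  · simpa using ht₁
  rintro m₂ o ⟨rfl, hF₂, ht₂⟩
  have hF₂' : Frame (regs g {.tally, .idx}) m m₂ :=
    ((hF₁.mono (Set.image_mono (by simp))).put (by simp) _ _).trans hF₂
  have hc₁ : m₁ (arr g .color) = m (arr g .color) := hF₁ _ (by simp)
  have hw₁ : m₁ (arr g .weight) = m (arr g .weight) := hF₁ _ (by simp)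
  refine (Run.seq ((run_argmin hKpos).imp ?_) (T₂ := 60 * 2 ^ i + 30)).le (by omega)
  rintro m₃ o ⟨rfl, hF₃, a, ha, harg, hmin⟩
  have hF₃' : Frame (regs g {.tally, .idx, .best, .arg}) m m₃ :=
    (hF₂'.mono (Set.image_mono (by intro r; simp; tauto))).trans
      (hF₃.mono (Set.image_mono (by intro r; simp; tauto)))
  have hc₃ : m₃ (arr g .color) = m (arr g .color) := hF₃' _ (by simp)
  have hw₃ : m₃ (arr g .weight) = m (arr g .weight) := hF₃' _ (by simp)
  refine (Run.set_seq (Run.seq ((run_extendLoop (K := K) (a := a) (n := 2 ^ i) ?_ (by simp) ?_ ?_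
    ?_).imp ?_) (T₂ := 7))).le (by simp; omega)
  · simp [hF₃' (arr g .pow) (by simp), hpow]
  · simp [harg]
  · intro u hu
    simp [hF₃' (arr g .table) (by simp), htab a ha u hu]
  · intro r hr'
    simpa [hc₃] using hr.lt r hr'
  rintro m₄ o ⟨rfl, hF₄, hc₄, hw₄⟩
  have hpow₄ : m₄ (arr g .pow) 0 = 2 ^ i := by
    rw [hF₄ _ (by simp), Memory.put_ne _ _ _ (by simp), hF₃' _ (by simp), hpow]
  simp only [Memory.put_ne, ne_eq, arr_inj, reduceCtorEq, not_false_eq_true, hc₃, hw₃,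
    eval_lit] at hc₄ hw₄
  have hlow : ∀ x < 2 ^ i, m₄ (arr g .color) x = m (arr g .color) x := fun x hx => by
    rw [hc₄, if_neg (by omega)]
  have hhigh : ∀ r < 2 ^ i, m₄ (arr g .color) (2 ^ i + r) = a ^^^ m (arr g .color) r :=
    fun r hr => by
      rw [hc₄, if_pos (by omega), Nat.add_sub_cancel_left]
  have hsplit : ∀ x < 2 ^ (i + 1), x < 2 ^ i ∨ ∃ r < 2 ^ i, x = 2 ^ i + r := by
    intro x hx
    rw [pow_succ] at hx
    rcases lt_or_ge x (2 ^ i) with h | h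
    · exact Or.inl h
    · exact Or.inr ⟨x - 2 ^ i, by omega, by omega⟩
  refine (Run.set ⟨rfl, ?_, ?_, ⟨?_, ?_, ?_, ?_⟩, ?_⟩).le (by simp)
  · refine (((hF₃'.mono (Set.image_mono ?_)).put (by simp [roundRegs]) _ _).trans
      (hF₄.mono (Set.image_mono ?_))).put (by simp [roundRegs]) _ _
    · intro r; simp [roundRegs]; tauto
    · intro r; simp [roundRegs]; tauto
  · simp [hpow₄]; ring
  · have : 0 < 2 ^ i := by positivity
    simpa [hlow 0 this] using hr.zero
  · intro x hx
    simp only [Memory.put_ne, ne_eq, arr_inj, reduceCtorEq, not_false_eq_true]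
    rcases hsplit x hx with hx | ⟨r, hr', rfl⟩
    · rw [hlow x hx]; exact hr.lt x hx
    · rw [hhigh r hr']; exact Nat.xor_lt_two_pow ha (hr.lt r hr')
  · intro j hj
    simp only [Memory.put_ne, ne_eq, arr_inj, reduceCtorEq, not_false_eq_true]
    rcases Nat.lt_succ_iff_lt_or_eq.1 hj with hj | rfl
    · obtain ⟨b, hb1, hb2⟩ := hr.step j hj
      have hpl : 2 ^ j + 2 ^ j ≤ 2 ^ i := by
        have := Nat.pow_le_pow_right two_pos hj
        rw [Nat.succ_eq_add_one, pow_succ] at this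
        omega
      refine ⟨b, fun r hr => ?_, ?_⟩
      · rw [hlow _ (by omega), hlow _ (by omega), hb1 r hr]
      · refine le_trans (le_of_eq ?_) hb2
        congr 1
        refine Finset.sum_congr rfl fun r hr => ?_
        have := Finset.mem_range.1 hr
        rw [hlow r (by omega)]
    · refine ⟨a, fun r hr => ?_, ?_⟩
      · rw [hhigh r hr, hlow r hr]
      · have hsum : ∀ b < K, m₂ (arr g .tally) b = ∑ r ∈ Finset.range (2 ^ j),
            (if m₄ (arr g .color) r = b then w (2 ^ j + r) + 1 else 0) := by
          intro b hb
          rw [ht₂ b hb]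
          refine Finset.sum_congr rfl fun r hr => ?_
          have := Finset.mem_range.1 hr
          simp only [Memory.put_ne, ne_eq, arr_inj, reduceCtorEq, not_false_eq_true, hc₁, hw₁]
          rw [hlow r this, hw _ (by omega)]
        rw [← hsum a ha]
        -- The minimum is at most the average. The tallies add up to the weight of the whole block
        -- because each `r` has exactly one colour below `K`.
        calc K * m₂ (arr g .tally) a = ∑ b ∈ Finset.range K, m₂ (arr g .tally) a := by simp
          _ ≤ ∑ b ∈ Finset.range K, m₂ (arr g .tally) b :=
            Finset.sum_le_sum fun b hb => hmin b (Finset.mem_range.1 hb)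
          _ = ∑ b ∈ Finset.range K, ∑ r ∈ Finset.range (2 ^ j),
              (if m₄ (arr g .color) r = b then w (2 ^ j + r) + 1 else 0) :=
            Finset.sum_congr rfl fun b hb => hsum b (Finset.mem_range.1 hb)
          _ = _ := by
            rw [Finset.sum_comm]
            refine Finset.sum_congr rfl fun r hr' => ?_
            have h1 := Finset.mem_range.1 hr'
            have h2 := hr.lt r h1
            rw [← hlow r h1] at h2
            rw [Finset.sum_ite_eq, if_pos (Finset.mem_range.2 h2)]
  · intro x hx0 hx
    simp only [Memory.put_ne, ne_eq, arr_inj, reduceCtorEq, not_false_eq_true]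
    rcases hsplit x hx with hx | ⟨r, hr', rfl⟩
    · rw [hlow x hx, hw₄, if_neg (by omega), hr.weight x hx0 hx]
    · rw [hhigh r hr', hw₄, hw _ (by omega), Nat.add_sub_cancel_left]
      by_cases h0 : a ^^^ m (arr g .color) r = 0
      · rw [if_pos h0, if_pos ⟨by omega, by omega, h0⟩]
      · rw [if_neg h0, if_neg (fun h => h0 h.2.2)]
  · intro x hx
    simp only [Memory.put_ne, ne_eq, arr_inj, reduceCtorEq, not_false_eq_true]
    rw [pow_succ] at hx
    rw [hw₄, if_neg (by omega), hw x (by omega)]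

/-- Choose a colouring of the numbers below `size`. -/
def chooseColor (g K : ℕ) : Prog :=
  .seq (.write (arr g .color) (.lit 0) (.lit 0))
    (.seq (.set g .pow (.lit 1))
      (.loop (.sub (.reg g .size) (.reg g .pow)) (extend g K)))

theorem sum_range_two_pow_le (l : ℕ) :
    ∑ n ∈ Finset.range l, 2 ^ (l - (n + 1)) ≤ 2 ^ l := by
  have h : ∑ n ∈ Finset.range l, 2 ^ (l - (n + 1)) = ∑ n ∈ Finset.range l, 2 ^ n := by
    rw [← Finset.sum_range_reflect (fun n => 2 ^ n)]
    refine Finset.sum_congr rfl fun n _ => ?_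
    congr 1; omega
  rw [h]
  clear h
  induction l with
  | zero => simp
  | succ l ih => rw [Finset.sum_range_succ, pow_succ]; omega

/-- The costs of the blocks form a geometric series, and the overhead `O(K)` of each of the `l`
blocks is absorbed by `l < 2 ^ l`. -/
theorem run_chooseColor {g s l : ℕ} {m : Memory} {out : List (List ℕ)}
    (htab : TableOk g (2 ^ s) m) (hsize : m (arr g .size) 0 = 2 ^ l) :
    Run (chooseColor g (2 ^ s)) m out (300 * 2 ^ s * 2 ^ l) fun m' o => o = out ∧
      Frame (regs g roundRegs) m m' ∧
      IsRound l (2 ^ s) (m (arr g .weight)) (m' (arr g .color)) (m' (arr g .weight)) := by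
  unfold chooseColor
  refine (Run.put_seq (Run.set_seq ((Run.loop (fun n m' o => o = out ∧ n ≤ l ∧
    Frame (regs g roundRegs) m m' ∧ m' (arr g .pow) 0 = 2 ^ (l - n) ∧
    IsRound (l - n) (2 ^ s) (m (arr g .weight)) (m' (arr g .color)) (m' (arr g .weight)) ∧
    ∀ x, 2 ^ (l - n) ≤ x → m' (arr g .weight) x = m (arr g .weight) x)
    (fun n => 100 * 2 ^ (l - (n + 1)) + 30 * 2 ^ s + 70) ?_ ?_ l _ out ?_).imp ?_))).le ?_
  · rintro m' o ⟨rfl, -, hF, hp, -⟩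
    simp [hp, hF (arr g .size) (by simp [roundRegs]), hsize]
  · rintro n m' o ⟨rfl, hn, hF, hp, hr, hw⟩
    refine ⟨?_, ?_⟩
    · have : 2 ^ (l - (n + 1)) < 2 ^ l := Nat.pow_lt_pow_right one_lt_two (by omega)
      simp [hp, hF (arr g .size) (by simp [roundRegs]), hsize]
      omega
    · have htab' : TableOk g (2 ^ s) m' := fun a ha u hu => by
        rw [hF _ (by simp [roundRegs]), htab a ha u hu]
      refine (run_extend htab' hp hr hw).imp ?_
      rw [show l - (n + 1) + 1 = l - n by omega]
      rintro m'' o ⟨rfl, h1, h2, h3, h4⟩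
      exact ⟨rfl, by omega, hF.trans h1, h2, h3, h4⟩
  · refine ⟨rfl, le_rfl, ((Frame.refl _ _).put (by simp [roundRegs]) _ _).put
      (by simp [roundRegs]) _ _, by simp, ⟨?_, ?_, ?_, ?_⟩, ?_⟩
    · simp
    · simp
    · simp
    -- With no bits there is no nonzero number, so the empty round holds vacuously.
    · intro x h1 h2
      simp at h2
      omega
    · intro x _
      simp
  · rintro m' o ⟨h1, -, h2, -, h3, -⟩
    exact ⟨h1, h2, by simpa using h3⟩
  · have h1 := sum_range_two_pow_le l
    have h2 : l < 2 ^ l := Nat.lt_two_pow_self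
    have h3 : 1 ≤ 2 ^ s := Nat.one_le_two_pow
    simp only [cost_sub, cost_reg, cost_lit, Finset.sum_add_distrib, Finset.sum_const,
      Finset.card_range, smul_eq_mul, ← Finset.mul_sum]
    generalize ∑ n ∈ Finset.range l, 2 ^ (l - (n + 1)) = Z at *
    generalize 2 ^ s = K at *
    generalize 2 ^ l = N at *
    have h4 : l * K ≤ N * K := Nat.mul_le_mul_right _ h2.le
    have h5 : N * 1 ≤ N * K := Nat.mul_le_mul_left _ h3
    nlinarith

/-- Fill the table of the exclusive or. -/
def fillTable (g K : ℕ) : Prog :=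
  seqAll ((List.range (K * K)).map fun j =>
    .write (arr g .table) (.lit j) (.lit ((j / K) ^^^ (j % K))))

theorem run_fillTable {g K : ℕ} {m : Memory} {out : List (List ℕ)} :
    Run (fillTable g K) m out (3 * (K * K) + 1) fun m' o => o = out ∧
      Frame (regs g {.table}) m m' ∧ TableOk g K m' := by
  refine (Run.seqAll _ (fun pre m' o => o = out ∧ Frame (regs g {.table}) m m' ∧
    ∀ j ∈ pre, m' (arr g .table) j = (j / K) ^^^ (j % K)) (fun _ => 3) (List.range (K * K))
    ?_ ?_).mono ?_ ?_
  · rintro pre j post - m' o ⟨rfl, hF, h⟩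
    refine (Run.put ⟨rfl, hF.put (by simp) _ _, ?_⟩).le (by simp)
    intro j' hj'
    by_cases hjj : j' = j
    · simp [hjj]
    · have : j' ∈ pre := by simpa [hjj] using hj'
      simp [hjj, h j' this]
  · exact ⟨rfl, Frame.refl _ _, by simp⟩
  · simp [mul_comm]
  · rintro m' o ⟨h1, h2, h3⟩
    refine ⟨h1, h2, fun a ha u hu => ?_⟩
    have hK : 0 < K := by omega
    rw [h3 (a * K + u) (List.mem_range.2 (by nlinarith)), Nat.mul_add_mod', Nat.mod_eq_of_lt hu]
    · rw [mul_comm a K, Nat.mul_add_div hK, Nat.div_eq_of_lt hu, Nat.add_zero]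

/-- Find a power of two that exceeds the number of values, and the number of rounds. -/
def findSize (g K : ℕ) : Prog :=
  .seq (.set g .size (.lit 1))
    (.seq (.set g .rounds (.lit K))
      (.loop (.sub (.add (.reg g .ids) (.lit 1)) (.reg g .size))
        (.seq (.set g .size (.add (.reg g .size) (.reg g .size)))
          (.set g .rounds (.add (.reg g .rounds) (.lit K))))))

/-- Doubling `size` until it exceeds `ids` takes as many steps as `ids` has binary digits. Adding
`K` at each step yields `K * (l + 1)` without multiplication. -/
theorem run_findSize {g K : ℕ} {m : Memory} {out : List (List ℕ)} :
    Run (findSize g K) m out (30 * (m (arr g .ids) 0).size + 20) fun m' o => o = out ∧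
      Frame (regs g {.size, .rounds}) m m' ∧
      m' (arr g .size) 0 = 2 ^ (m (arr g .ids) 0).size ∧
      m' (arr g .rounds) 0 = K * ((m (arr g .ids) 0).size + 1) := by
  unfold findSize
  set l := (m (arr g .ids) 0).size with hl
  refine (Run.set_seq (Run.set_seq ((Run.loop (fun n m' o => o = out ∧ n ≤ l ∧
    Frame (regs g {.size, .rounds}) m m' ∧ m' (arr g .size) 0 = 2 ^ (l - n) ∧
    m' (arr g .rounds) 0 = K * (l - n + 1)) (fun _ => 20) ?_ ?_ l _ out ?_).imp ?_))).le ?_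
  · rintro m' o ⟨rfl, -, hF, hs, -⟩
    have := Nat.lt_size_self (m (arr g .ids) 0)
    rw [← hl] at this
    rw [Nat.sub_zero] at hs
    simp [hs, hF (arr g .ids) (by simp)]
    omega
  · rintro n m' o ⟨rfl, hn, hF, hs, hr⟩
    refine ⟨?_, (Run.set_seq (Run.set ⟨rfl, by omega, ?_, ?_, ?_⟩)).le (by simp)⟩
    · have : 2 ^ (l - (n + 1)) ≤ m (arr g .ids) 0 := Nat.lt_size.1 (by omega)
      simp [hs, hF (arr g .ids) (by simp)]
      omega
    · exact (hF.put (by simp) _ _).put (by simp) _ _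
    · rw [show l - n = l - (n + 1) + 1 by omega]
      simp [hs]; ring
    · rw [show l - n = l - (n + 1) + 1 by omega]
      simp [hr]; ring
  · exact ⟨rfl, le_rfl, ((Frame.refl _ _).put (by simp) _ _).put (by simp) _ _, by simp, by simp⟩
  · rintro m' o ⟨h1, -, h2, h3, h4⟩
    exact ⟨h1, h2, by simpa using h3, by simpa using h4⟩
  · simp; omega


/-! ### Queries on filtered databases -/

/-- The variable `x` occurs in the body at position `j` of an atom of the relation `i`. -/
def Query.Occurs {S : Schema} (q : Query S) (i : Fin S.numRel) (j : Fin (S.arity i)) (x : ℕ) :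
    Prop :=
  ∃ a ∈ q.atoms, ∃ j', (⟨a.rel, j'⟩ : (i : Fin S.numRel) × Fin (S.arity i)) = ⟨i, j⟩ ∧
    a.args j' = .var x

open Classical in
/-- The colour that the entry of a tuple must have if the variables in `V` have the
colours `c`. -/
noncomputable def Query.req {S : Schema} (q : Query S) {V : Finset ℕ} {K : ℕ} (c : V → Fin K)
    (i : Fin S.numRel) (j : Fin (S.arity i)) : Option ℕ :=
  if h : ∃ x : V, q.Occurs i j x then some (c h.choose) else none

section Semantics

variable {S : Schema} {q : Query S} {V : Finset ℕ} {K : ℕ} {c : V → Fin K}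

/-- Self-join-freeness enters here: the relation symbol determines the atom, so at most one variable
occurs at a given position, and the choice made in `Query.req` is forced. -/
theorem Query.SelfJoinFree.arg_eq (hq : q.SelfJoinFree) {a : Atom S} (ha : a ∈ q.atoms)
    {j : Fin (S.arity a.rel)} {x : ℕ} (h : q.Occurs a.rel j x) : a.args j = .var x := by
  obtain ⟨a', ha', j', he, hx⟩ := h
  have : a' = a := List.inj_on_of_nodup_map hq ha' ha (congrArg Sigma.fst he)
  subst this
  simp only [Sigma.mk.injEq, heq_eq_eq, true_and] at he
  rwa [← he]

theorem Query.exists_of_req_eq_some {i : Fin S.numRel} {j : Fin (S.arity i)} {n : ℕ}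
    (h : q.req c i j = some n) : ∃ x : V, q.Occurs i j x ∧ (c x : ℕ) = n := by
  unfold Query.req at h
  split_ifs at h with hx
  exact ⟨_, hx.choose_spec, by simpa using h⟩

theorem Query.SelfJoinFree.req_eq (hq : q.SelfJoinFree) {a : Atom S} (ha : a ∈ q.atoms)
    {j : Fin (S.arity a.rel)} {x : V} (h : a.args j = .var x) :
    q.req c a.rel j = some (c x : ℕ) := by
  have hx : ∃ x : V, q.Occurs a.rel j x := ⟨x, a, ha, j, rfl, h⟩
  unfold Query.req
  rw [dif_pos hx]
  have h1 := hq.arg_eq ha hx.choose_spec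
  rw [h] at h1
  rw [Subtype.ext (Arg.var.inj h1)]

/-- The filter forces the value of each variable to have its prescribed colour, and values of
different colours differ. A variable is constrained only through its occurrences in the body, hence
`hI`. -/
theorem Query.SelfJoinFree.answer_restrict_subset (hq : q.SelfJoinFree) {I : Finset (ℕ × ℕ)}
    (hI : ∀ p ∈ I, p.1 ∈ q.vars ∧ p.2 ∈ q.vars) {D : Database S} {col : ℕ → ℕ}
    {c : ineqVars I → Fin K}
    (hc : ∀ p ∈ I, ∀ h₁ h₂, c ⟨p.1, h₁⟩ ≠ c ⟨p.2, h₂⟩) :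
    q.answer ∅ (D.restrict col (q.req c)) ⊆ q.answer I D := by
  rintro u ⟨ν, hν, -, rfl⟩
  have hmem : ∀ a ∈ q.atoms, (fun j => (a.args j).val ν) ∈ D.rel a.rel ∧
      Keeps col (q.req c a.rel) fun j => (a.args j).val ν := fun a ha => by
    simpa [Database.restrict] using hν a ha
  have hcol : ∀ x (hx : x ∈ ineqVars I), x ∈ q.vars → col (ν x) = c ⟨x, hx⟩ := by
    rintro x hx ⟨a, ha, j, hj⟩
    have := (hmem a ha).2 j _ (hq.req_eq ha (c := c) (x := ⟨x, hx⟩) hj)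
    simpa [hj, Arg.val] using this
  refine ⟨ν, fun a ha => (hmem a ha).1, fun p hp he => ?_, rfl⟩
  have h₁ : p.1 ∈ ineqVars I := Finset.mem_union_left _ (Finset.mem_image_of_mem _ hp)
  have h₂ : p.2 ∈ ineqVars I := Finset.mem_union_right _ (Finset.mem_image_of_mem _ hp)
  apply hc p hp h₁ h₂
  apply Fin.ext
  rw [← hcol _ h₁ (hI p hp).1, ← hcol _ h₂ (hI p hp).2, he]

theorem Query.SelfJoinFree.mem_answer_restrict (hq : q.SelfJoinFree) {D : Database S}
    {col : ℕ → ℕ} {ν : ℕ → ℕ} (hν : ∀ a ∈ q.atoms, (fun j => (a.args j).val ν) ∈ D.rel a.rel)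
    (hc : ∀ x : V, col (ν x) = c x) :
    q.head.map ν ∈ q.answer ∅ (D.restrict col (q.req c)) := by
  refine ⟨ν, fun a ha => ?_, by simp, rfl⟩
  simp only [Database.restrict, List.mem_filter, decide_eq_true_eq]
  refine ⟨hν a ha, fun j n hn => ?_⟩
  obtain ⟨x, hx, rfl⟩ := Query.exists_of_req_eq_some hn
  simpa [hq.arg_eq ha hx, Arg.val] using hc x

/-- All the values of the database. -/
def Database.values (D : Database S) : List ℕ := (List.finRange S.numRel).flatMap D.cells

theorem Database.mem_values {D : Database S} {i : Fin S.numRel} {t : Fin (S.arity i) → ℕ}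
    (ht : t ∈ D.rel i) (j : Fin (S.arity i)) : t j ∈ D.values :=
  List.mem_flatMap.2 ⟨i, List.mem_finRange i,
    List.mem_flatMap.2 ⟨t, ht, by rw [List.mem_ofFn]; exact ⟨j, rfl⟩⟩⟩

theorem Database.length_values_le (D : Database S) : D.values.length ≤ D.size := by
  rw [Database.values, List.length_flatMap, ← Fin.sum_univ_def, Database.size]
  refine Finset.sum_le_sum fun i _ => ?_
  rw [Database.cells, length_flatMap_ofFn]
  omega

theorem Query.valuation_mem_values {D : Database S} {ν : ℕ → ℕ}
    (hν : ∀ a ∈ q.atoms, (fun j => (a.args j).val ν) ∈ D.rel a.rel) {x : ℕ} (hx : x ∈ q.vars) :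
    ν x ∈ D.values := by
  obtain ⟨a, ha, j, hj⟩ := hx
  have := Database.mem_values (hν a ha) j
  simpa [hj, Arg.val] using this

theorem Query.mem_values_of_mem_answer {D : Database S} {I : Finset (ℕ × ℕ)} {u : List ℕ}
    (hu : u ∈ q.answer I D) : u.length = q.head.length ∧ ∀ v ∈ u, v ∈ D.values := by
  obtain ⟨ν, hν, -, rfl⟩ := hu
  refine ⟨by simp, fun v hv => ?_⟩
  obtain ⟨x, hx, rfl⟩ := List.mem_map.1 hv
  exact q.valuation_mem_values hν (q.safe x hx)

end Semantics

/-! ### The evaluation program -/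

open Classical in
/-- The assignments of colours to the variables of the inequalities that satisfy them. -/
noncomputable def colorings (I : Finset (ℕ × ℕ)) (K : ℕ) : List (ineqVars I → Fin K) :=
  (Finset.univ.filter fun c : ineqVars I → Fin K =>
    ∀ p ∈ I, ∀ h₁ h₂, c ⟨p.1, h₁⟩ ≠ c ⟨p.2, h₂⟩).toList

theorem mem_colorings {I : Finset (ℕ × ℕ)} {K : ℕ} {c : ineqVars I → Fin K} :
    c ∈ colorings I K ↔ ∀ p ∈ I, ∀ h₁ h₂, c ⟨p.1, h₁⟩ ≠ c ⟨p.2, h₂⟩ := by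
  simp [colorings]

theorem length_colorings_le (I : Finset (ℕ × ℕ)) (K : ℕ) :
    (colorings I K).length ≤ K ^ (ineqVars I).card := by
  classical
  rw [colorings, Finset.length_toList]
  refine (Finset.card_filter_le _ _).trans ?_
  simp

/-- The registers that one simulated run of the given program modifies. -/
def runRegs : Set Reg := insert .base loadRegs ∪ simRegs

/-- Loading erases what the previous run left in the simulated memory, while the trie is kept, so
the output accumulates as a union without repetitions. -/
theorem run_restricted {S : Schema} {q : Query S} {D : Database S} {p : Prog} {τ : ℕ}
    {col : ℕ → ℕ} {req : (i : Fin S.numRel) → Fin (S.arity i) → Option ℕ}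
    (hp : ∃ s t, Exec p ⟨(D.restrict col req).initMem, []⟩ s t ∧ t ≤ τ ∧
      ∀ u, u ∈ s.out ↔ u ∈ q.answer ∅ (D.restrict col req))
    {m : Memory} {out : List (List ℕ)} {h : ℕ}
    (hgood : ∀ u ∈ q.answer ∅ (D.restrict col req), u.length = h ∧
      ∀ v ∈ u, v < m (arr S.top .width) 0)
    (hin : InputOk D m) (hc : Capped S.top m)
    (hcol : ∀ v, m (arr S.top .color) (m (arr S.top .dict) v) = col v)
    (hrec : Recorded S.top h m out) :
    Run (.seq (loadAll S req) (p.sim S.top)) m out (260 * D.size + 160 * τ + 10) fun m' o =>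
      Capped S.top m' ∧ Recorded S.top h m' o ∧
      (∀ u, u ∈ o ↔ u ∈ out ∨ u ∈ q.answer ∅ (D.restrict col req)) ∧
      Frame (regs S.top runRegs ∪ simArrs S.top) m m' := by
  obtain ⟨s, t, hx, ht, hs⟩ := hp
  refine (Run.seq ((run_loadAll D col req hin hc hcol).imp ?_) (T₂ := 160 * t)).le (by omega)
  rintro m' o ⟨rfl, h1, h2, h3⟩
  have hw : m' (arr S.top .width) = m (arr S.top .width) := h3 _ (by simp [loadRegs])
  refine (run_sim hx (m (arr S.top .width) 0) o (h := h) (fun u hu => hgood u ((hs u).1 hu))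
    m' o (by rw [hw]) h2 h1 (hrec.congr hw ?_ ?_ ?_) (by simp)).imp ?_
  · exact h3 _ (by simp [loadRegs])
  · exact h3 _ (by simp [loadRegs])
  · exact h3 _ (by simp [loadRegs])
  · rintro m'' o' ⟨-, q1, q2, q3, q4⟩
    refine ⟨q1, q2, fun u => by rw [q3, hs], (h3.mono ?_).trans (q4.mono ?_)⟩
    · exact Set.union_subset_union_left _ (Set.image_mono Set.subset_union_left)
    · exact Set.union_subset_union_left _ (Set.image_mono Set.subset_union_right)

/-- Evaluate the query on the databases that are obtained from one colouring. -/
noncomputable def roundProg {S : Schema} (q : Query S) (I : Finset (ℕ × ℕ)) (p : Prog) (K : ℕ) :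
    Prog :=
  .seq (chooseColor S.top K)
    (.seq (seqAll ((colorings I K).map fun c => .seq (loadAll S (q.req c)) (p.sim S.top)))
      (.set S.top .rounds (.sub (.reg S.top .rounds) (.lit 1))))

/-- Evaluate the query with inequalities, given a program `p` for the query without
inequalities. -/
noncomputable def mainProg {S : Schema} (q : Query S) (I : Finset (ℕ × ℕ)) (p : Prog) (K : ℕ) :
    Prog :=
  .seq (fillTable S.top K)
    (.seq (scanAll S)
      (.seq (.set S.top .next (.reg S.top .width))
        (.seq (findSize S.top K)
          (.loop (.reg S.top .rounds) (roundProg q I p K)))))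

/-- The state between two rounds, after the colourings `fs` of the numbers `dict v` of the
values `v` have been used. -/
structure MainInv {S : Schema} (q : Query S) (I : Finset (ℕ × ℕ)) (D : Database S) (K l : ℕ)
    (dict : ℕ → ℕ) (fs : List (ℕ → ℕ)) (m : Memory) (o : List (List ℕ)) : Prop where
  input : InputOk D m
  capped : Capped S.top m
  table : TableOk S.top K m
  dict_eq : m (arr S.top .dict) = dict
  width : ∀ v ∈ D.values, v < m (arr S.top .width) 0
  size : m (arr S.top .size) 0 = 2 ^ l
  rounds : m (arr S.top .rounds) 0 + fs.length = K * (l + 1)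
  history : IsHistory l K fs (m (arr S.top .weight))
  recorded : Recorded S.top q.head.length m o
  mem_iff : ∀ u, u ∈ o ↔ ∃ f ∈ fs, ∃ c ∈ colorings I K,
    u ∈ q.answer ∅ (D.restrict (fun v => f (dict v)) (q.req c))

theorem run_roundProg {S : Schema} {q : Query S} (hq : q.SelfJoinFree) {I : Finset (ℕ × ℕ)}
    (hI : ∀ p ∈ I, p.1 ∈ q.vars ∧ p.2 ∈ q.vars) {D : Database S} {p : Prog} {s τ l : ℕ}
    (hp : ∀ col req, ∃ s t, Exec p ⟨(D.restrict col req).initMem, []⟩ s t ∧ t ≤ τ ∧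
      ∀ u, u ∈ s.out ↔ u ∈ q.answer ∅ (D.restrict col req))
    {dict : ℕ → ℕ} {fs : List (ℕ → ℕ)} {m : Memory} {out : List (List ℕ)}
    (H : MainInv q I D (2 ^ s) l dict fs m out) (hr : m (arr S.top .rounds) 0 ≠ 0) :
    Run (roundProg q I p (2 ^ s)) m out (300 * 2 ^ s * 2 ^ l +
        (2 ^ s) ^ (ineqVars I).card * (260 * D.size + 160 * τ + 10) + 10) fun m' o =>
      m' (arr S.top .rounds) 0 + 1 = m (arr S.top .rounds) 0 ∧
      ∃ f, MainInv q I D (2 ^ s) l dict (f :: fs) m' o := by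
  unfold roundProg
  refine (Run.seq ((run_chooseColor H.table H.size).imp ?_)
    (T₂ := (2 ^ s) ^ (ineqVars I).card * (260 * D.size + 160 * τ + 10) + 10)).le (by omega)
  rintro m₁ o ⟨rfl, hF₁, hround⟩
  have hin₁ := H.input.of_frame_regs hF₁
  have hdict₁ : m₁ (arr S.top .dict) = dict := by rw [hF₁ _ (by simp [roundRegs]), H.dict_eq]
  have hrec₁ : Recorded S.top q.head.length m₁ o := H.recorded.congr
    (hF₁ _ (by simp [roundRegs])) (hF₁ _ (by simp [roundRegs])) (hF₁ _ (by simp [roundRegs]))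
    (hF₁ _ (by simp [roundRegs]))
  set f := m₁ (arr S.top .color) with hf
  refine (Run.seq ((Run.seqAll _ (fun pre m' o' => Capped S.top m' ∧
    Frame (regs S.top runRegs ∪ simArrs S.top) m₁ m' ∧ Recorded S.top q.head.length m' o' ∧
    ∀ u, u ∈ o' ↔ u ∈ o ∨ ∃ c ∈ pre, u ∈ q.answer ∅ (D.restrict (fun v => f (dict v)) (q.req c)))
    (fun _ => 260 * D.size + 160 * τ + 10) (colorings I (2 ^ s)) ?_ ?_).imp ?_) (T₂ := 6)).le ?_
  · rintro pre c post hl m' o' ⟨h1, h2, h3, h4⟩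
    have hc : c ∈ colorings I (2 ^ s) := by rw [hl]; simp
    have hsub := hq.answer_restrict_subset (D := D) (col := fun v => f (dict v)) hI
      (mem_colorings.1 hc)
    refine (run_restricted (hp (fun v => f (dict v)) (q.req c)) (h := q.head.length) ?_
      (hin₁.of_frame h2) h1 ?_ h3).imp ?_
    · intro u hu
      obtain ⟨hu1, hu2⟩ := Query.mem_values_of_mem_answer (hsub hu)
      refine ⟨hu1, fun v hv => ?_⟩
      rw [h2 _ (by simp [runRegs, loadRegs, simRegs]), hF₁ _ (by simp [roundRegs])]
      exact H.width v (hu2 v hv)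
    · intro v
      rw [h2 _ (by simp [runRegs, loadRegs, simRegs]),
        h2 (arr S.top .dict) (by simp [runRegs, loadRegs, simRegs]), hdict₁]
    · rintro m'' o'' ⟨q1, q2, q3, q4⟩
      refine ⟨q1, h2.trans q4, q2, fun u => ?_⟩
      rw [q3, h4, or_assoc]
      simp [or_and_right, exists_or]
  · exact ⟨H.capped.of_frame hF₁ (by simp [roundRegs]) (by simp [roundRegs]), Frame.refl _ _,
      hrec₁, by simp⟩
  · rintro m₂ o₂ ⟨hc₂, hF₂, hrec₂, ho₂⟩
    have hrd : m₂ (arr S.top .rounds) 0 = m (arr S.top .rounds) 0 := by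
      rw [hF₂ _ (by simp [runRegs, loadRegs, simRegs]), hF₁ _ (by simp [roundRegs])]
    have hF₃ : Frame (regs S.top {.rounds}) m₂ (m₂.put (arr S.top .rounds) 0
        ((Expr.sub (.reg S.top .rounds) (.lit 1)).eval m₂)) := (Frame.refl _ _).put (by simp) _ _
    refine (Run.set ⟨?_, f, ?_, ?_, ?_, ?_, ?_, ?_, ?_, ?_, ?_, ?_⟩).le (by simp)
    · simp [hrd]; omega
    · exact (hin₁.of_frame hF₂).of_frame_regs hF₃
    · exact hc₂.of_frame hF₃ (by simp) (by simp)
    · intro a ha u hu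
      rw [hF₃ _ (by simp), hF₂ _ (by simp [runRegs, loadRegs, simRegs]),
        hF₁ _ (by simp [roundRegs]), H.table a ha u hu]
    · rw [hF₃ _ (by simp), hF₂ _ (by simp [runRegs, loadRegs, simRegs]), hdict₁]
    · rw [hF₃ _ (by simp), hF₂ _ (by simp [runRegs, loadRegs, simRegs]),
        hF₁ _ (by simp [roundRegs])]
      exact H.width
    · rw [hF₃ _ (by simp), hF₂ _ (by simp [runRegs, loadRegs, simRegs]),
        hF₁ _ (by simp [roundRegs]), H.size]
    · have := H.rounds
      simp [hrd]; omega
    · rw [hF₃ _ (by simp), hF₂ _ (by simp [runRegs, loadRegs, simRegs])]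
      exact H.history.cons hround
    · exact hrec₂.congr (hF₃ _ (by simp)) (hF₃ _ (by simp)) (hF₃ _ (by simp)) (hF₃ _ (by simp))
    · intro u
      rw [ho₂, H.mem_iff]
      simp only [List.mem_cons, or_and_right, exists_or, exists_eq_left]
      rw [or_comm]
  · have := Nat.mul_le_mul_right (260 * D.size + 160 * τ + 10) (length_colorings_le I (2 ^ s))
    simp only [List.map_const', List.sum_replicate, smul_eq_mul]
    omega

/-- Soundness holds for every colouring; completeness comes from one that separates the numbers of
the values of the given valuation. -/
theorem MainInv.mem_answer_iff {S : Schema} {q : Query S} (hq : q.SelfJoinFree)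
    {I : Finset (ℕ × ℕ)} (hI : ∀ p ∈ I, p.1 ∈ q.vars ∧ p.2 ∈ q.vars) {D : Database S} {K l : ℕ}
    (hK : 0 < K) (hIK : 4 * I.card ≤ K) {dict : ℕ → ℕ} {fs : List (ℕ → ℕ)} {m : Memory}
    {o : List (List ℕ)} (H : MainInv q I D K l dict fs m o)
    (hinj : ∀ v ∈ D.values, ∀ w ∈ D.values, dict v = dict w → v = w)
    (hlt : ∀ v, dict v < 2 ^ l) (hdone : m (arr S.top .rounds) 0 = 0) (u : List ℕ) :
    u ∈ o ↔ u ∈ q.answer I D := by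
  rw [H.mem_iff]
  constructor
  · rintro ⟨f, -, c, hc, hu⟩
    exact hq.answer_restrict_subset hI (mem_colorings.1 hc) hu
  · rintro ⟨ν, hν, hne, rfl⟩
    have hlen : fs.length = K * (l + 1) := by have := H.rounds; omega
    obtain ⟨f, hf, hsep⟩ := H.history.exists_separating hK hlen I (fun p => dict (ν p.1))
      (fun p => dict (ν p.2)) hIK (fun _ _ => hlt _) (fun _ _ => hlt _) (fun p hp he =>
        hne p hp (hinj _ (q.valuation_mem_values hν (hI p hp).1) _
          (q.valuation_mem_values hν (hI p hp).2) he))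
    -- The right guess: each variable gets the colour of its own value.
    refine ⟨f, hf, fun x => ⟨f (dict (ν x)), (H.history.linear f hf).lt _ (hlt _)⟩, ?_, ?_⟩
    · rw [mem_colorings]
      intro p hp h₁ h₂ he
      exact hsep p hp (congrArg Fin.val he)
    · exact hq.mem_answer_restrict hν fun x => rfl

theorem two_pow_size_le (n : ℕ) : 2 ^ n.size ≤ 2 * n + 1 := by
  rcases Nat.eq_zero_or_pos n with rfl | hn
  · simp
  · have h1 : 0 < n.size := Nat.size_pos.2 hn
    have h2 : 2 ^ (n.size - 1) ≤ n := Nat.lt_size.1 (by omega)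
    have h3 : 2 ^ n.size = 2 * 2 ^ (n.size - 1) := by
      rw [← pow_succ']; congr 1; omega
    omega

theorem run_mainProg {S : Schema} {q : Query S} (hq : q.SelfJoinFree) {I : Finset (ℕ × ℕ)}
    (hI : ∀ p ∈ I, p.1 ∈ q.vars ∧ p.2 ∈ q.vars) {D : Database S} {p : Prog} {s τ : ℕ}
    (hIK : 4 * I.card ≤ 2 ^ s)
    (hp : ∀ col req, ∃ s t, Exec p ⟨(D.restrict col req).initMem, []⟩ s t ∧ t ≤ τ ∧
      ∀ u, u ∈ s.out ↔ u ∈ q.answer ∅ (D.restrict col req)) :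
    ∃ l, 2 ^ l ≤ 2 * D.size + 1 ∧ Run (mainProg q I p (2 ^ s)) D.initMem []
      (3 * (2 ^ s * 2 ^ s) + 200 * D.size + 30 * l + 50 +
        2 ^ s * (l + 1) * (300 * 2 ^ s * 2 ^ l +
          (2 ^ s) ^ (ineqVars I).card * (260 * D.size + 160 * τ + 10) + 20))
      fun _ o => o.Nodup ∧ ∀ u, u ∈ o ↔ u ∈ q.answer I D := by
  have hinit : ∀ a, D.initMem (S.top + a) = fun _ => 0 := by
    intro a
    funext j
    rw [Schema.top, show S.numRel + 1 + a = (S.numRel + a) + 1 by omega]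
    simp [Database.initMem]
  have hreg : ∀ r j, D.initMem (arr S.top r) j = 0 := fun r j => by rw [arr, hinit]
  obtain ⟨m₁, o₁, t₁, hx₁, ht₁, rfl, hF₁, htab₁⟩ :=
    run_fillTable (g := S.top) (K := 2 ^ s) (m := D.initMem) (out := [])
  have hin₁ : InputOk D m₁ := InputOk.of_frame_regs (fun _ _ => rfl) hF₁
  obtain ⟨m₂, o₂, t₂, hx₂, ht₂, rfl, hsc₂, hF₂⟩ := run_scanAll D (out := []) hin₁
    (by rw [hF₁ _ (by simp), hreg]) (fun v => by rw [hF₁ _ (by simp), hreg])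
  -- The first free node is `width`, the least positive multiple of itself; `0` is reserved for the
  -- root and for missing children.
  set m₃ := m₂.put (arr S.top .next) 0 (m₂ (arr S.top .width) 0) with hm₃
  have hF₃ : Frame (regs S.top (insert .table (insert .next scanRegs))) D.initMem m₃ := by
    refine ((hF₁.mono (Set.image_mono ?_)).trans (hF₂.mono (Set.image_mono ?_))).put
      (by simp) _ _
    · intro r; simp; tauto
    · intro r; simp; tauto
  obtain ⟨m₄, o₄, t₄, hx₄, ht₄, rfl, hF₄, hsize₄, hrounds₄⟩ :=
    run_findSize (g := S.top) (K := 2 ^ s) (m := m₃) (out := [])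
  set l := (m₃ (arr S.top .ids) 0).size with hl
  have hF₅ : Frame (regs S.top ({.size, .rounds, .next} ∪ insert .table scanRegs)) D.initMem m₄ := by
    refine (hF₃.mono (Set.image_mono ?_)).trans (hF₄.mono (Set.image_mono ?_))
    · intro r; simp; tauto
    · intro r; simp; tauto
  have hids : m₃ (arr S.top .ids) 0 ≤ D.size := by
    simp only [hm₃, Memory.put_ne, ne_eq, arr_inj, reduceCtorEq, not_false_eq_true]
    exact hsc₂.ids_le.trans D.length_values_le
  have hdict : m₄ (arr S.top .dict) = m₂ (arr S.top .dict) := by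
    rw [hF₄ _ (by simp), hm₃, Memory.put_ne _ _ _ (by simp)]
  have hids' : m₃ (arr S.top .ids) 0 = m₂ (arr S.top .ids) 0 := by
    rw [hm₃, Memory.put_ne _ _ _ (by simp)]
  have hwidth : m₄ (arr S.top .width) = m₂ (arr S.top .width) := by
    rw [hF₄ _ (by simp), hm₃, Memory.put_ne _ _ _ (by simp)]
  have hnext : m₄ (arr S.top .next) 0 = m₂ (arr S.top .width) 0 := by
    rw [hF₄ _ (by simp), hm₃]; simp
  have hzero : ∀ r, r ∉ ({.size, .rounds, .next} ∪ insert .table scanRegs : Set Reg) →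
      ∀ j, m₄ (arr S.top r) j = 0 := fun r hr j => by
    rw [hF₅ _ (by simpa using hr), hreg]
  have hzsim : ∀ a j, m₄ (simArr S.top a) j = 0 := fun a j => by
    rw [hF₅ _ simArr_notMem_regs, simArr, add_assoc, hinit]
  have hInv : MainInv q I D (2 ^ s) l (m₂ (arr S.top .dict)) [] m₄ [] := by
    refine ⟨?_, ⟨?_, ?_⟩, ?_, hdict, ?_, hsize₄, ?_, ?_, ⟨?_, ⟨?_, ?_, ?_, ?_⟩, ?_, ?_, ?_, ?_, ?_⟩,
      ?_⟩
    · exact InputOk.of_frame_regs (fun _ _ => rfl) hF₅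
    · rw [hzero .base (by simp [scanRegs])]; exact Nat.zero_le _
    · intro a j; rw [hzsim]; exact Nat.zero_le _
    · intro a ha u hu
      rw [hF₄ _ (by simp), hm₃, Memory.put_ne _ _ _ (by simp), hF₂ _ (by simp [scanRegs]),
        htab₁ a ha u hu]
    · rw [hwidth]; exact hsc₂.lt
    · rw [hrounds₄]; simp
    · exact IsHistory.nil _ _ fun x => hzero .weight (by simp [scanRegs]) x
    · rw [hwidth]; exact hsc₂.width_pos
    · intro x y _ h0
      exact absurd (hzero .trie (by simp [scanRegs]) x) h0
    · intro x
      rw [hzero .trie (by simp [scanRegs])]; exact dvd_zero _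
    · intro x
      rw [hzero .trie (by simp [scanRegs]), hnext]; exact hsc₂.width_pos
    · rw [hnext, hwidth]
    · simp
    · simp
    · simp
    · simp
    · intro n hn
      exact absurd (hzero .seen (by simp [scanRegs]) n) hn
    · simp
  have hloop := Run.loop (e := .reg S.top .rounds) (p := roundProg q I p (2 ^ s))
    (fun n m' o => m' (arr S.top .rounds) 0 = n ∧
      ∃ fs, MainInv q I D (2 ^ s) l (m₂ (arr S.top .dict)) fs m' o)
    (fun _ => 300 * 2 ^ s * 2 ^ l +
        (2 ^ s) ^ (ineqVars I).card * (260 * D.size + 160 * τ + 10) + 10)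
    (fun m' o h => h.1) (by
      rintro n m' o ⟨hn, fs, H⟩
      refine ⟨by simp [hn], (run_roundProg hq hI hp H (by omega)).imp ?_⟩
      rintro m'' o' ⟨h1, f, H'⟩
      exact ⟨by omega, f :: fs, H'⟩) (2 ^ s * (l + 1)) m₄ [] ⟨hrounds₄, [], hInv⟩
  refine ⟨l, (two_pow_size_le _).trans (by omega), ?_⟩
  unfold mainProg
  refine (Run.seq ⟨m₁, [], t₁, hx₁, ht₁, Run.seq ⟨m₂, [], t₂, hx₂, ht₂, Run.set_seq (Run.seq
    ⟨m₄, [], t₄, hx₄, ht₄, hloop.imp ?_⟩)⟩⟩).le ?_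
  · rintro m' o ⟨hd, fs, H⟩
    refine ⟨H.recorded.nodup, H.mem_answer_iff hq hI (by positivity) hIK ?_ ?_ hd⟩
    · intro v hv w hw he
      exact hsc₂.inj v w he (hsc₂.ne v hv)
    · intro v
      refine (hsc₂.le v).trans_lt ?_
      rw [← hids']
      exact Nat.lt_size_self _
  · simp only [cost_reg, Finset.sum_const, Finset.card_range, smul_eq_mul]
    have : 2 ^ s * (l + 1) * (2 + 1 + (300 * 2 ^ s * 2 ^ l +
        (2 ^ s) ^ (ineqVars I).card * (260 * D.size + 160 * τ + 10) + 10)) ≤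
      2 ^ s * (l + 1) * (300 * 2 ^ s * 2 ^ l +
        (2 ^ s) ^ (ineqVars I).card * (260 * D.size + 160 * τ + 10) + 20) :=
      Nat.mul_le_mul_left _ (by omega)
    omega

/-! ### The time bound -/

/-- Every summand is dominated by `K ^ (k + 2) * (l + 1) * max τ n`. One factor `K` comes from the
number of rounds, the other from the cost of choosing a colouring. -/
theorem total_le {K k l n τ : ℕ} (hK : 1 ≤ K) (hτ : 1 ≤ τ) (hl : 2 ^ l ≤ 2 * n + 1) :
    3 * (K * K) + 200 * n + 30 * l + 50 +
        K * (l + 1) * (300 * K * 2 ^ l + K ^ k * (260 * n + 160 * τ + 10) + 20) ≤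
      2000 * (K ^ (k + 2) * (l + 1) * max τ n) := by
  have hX : 1 ≤ max τ n := hτ.trans (le_max_left _ _)
  have hn : n ≤ max τ n := le_max_right _ _
  have hτX : τ ≤ max τ n := le_max_left _ _
  have hN : 2 ^ l ≤ 3 * max τ n := by omega
  have hP : 1 ≤ K ^ k := Nat.one_le_pow _ _ hK
  have hL : 1 ≤ l + 1 := by omega
  have hlL : l ≤ l + 1 := by omega
  rw [show K ^ (k + 2) = K ^ k * K * K by ring]
  generalize K ^ k = P at *
  generalize l + 1 = L at *
  generalize max τ n = X at *
  generalize 2 ^ l = N at *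
  have e1 : 1 * K * K * 1 * 1 ≤ P * K * K * L * X := by gcongr
  have e2 : 1 * 1 * 1 * 1 * n ≤ P * K * K * L * X := by gcongr
  have e3 : 1 * 1 * 1 * l * 1 ≤ P * K * K * L * X := by gcongr
  have e4 : 1 * 1 * 1 * 1 * 1 ≤ P * K * K * L * X := by gcongr
  have e5 : 1 * K * K * L * N ≤ P * K * K * L * (3 * X) := by gcongr
  have e6 : P * K * 1 * L * n ≤ P * K * K * L * X := by gcongr
  have e7 : P * K * 1 * L * τ ≤ P * K * K * L * X := by gcongr
  have e8 : P * K * 1 * L * 1 ≤ P * K * K * L * X := by gcongr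
  have e9 : 1 * K * 1 * L * 1 ≤ P * K * K * L * X := by gcongr
  have e : K * L * (300 * K * N + P * (260 * n + 160 * τ + 10) + 20) =
      300 * (1 * K * K * L * N) + 260 * (P * K * 1 * L * n) + 160 * (P * K * 1 * L * τ) +
        10 * (P * K * 1 * L * 1) + 20 * (1 * K * 1 * L * 1) := by ring
  rw [e]
  linarith

/-- The number of colours for `k` variables. -/
def numColors (k : ℕ) : ℕ := 2 ^ (2 * k.size + 2)

theorem four_mul_sq_le_numColors (k : ℕ) : 4 * k ^ 2 ≤ numColors k := by
  have h : k ^ 2 ≤ (2 ^ k.size) ^ 2 := Nat.pow_le_pow_left (Nat.lt_size_self k).le 2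
  calc 4 * k ^ 2 ≤ 4 * (2 ^ k.size) ^ 2 := Nat.mul_le_mul_left _ h
    _ = numColors k := by rw [numColors]; ring

/-- For `k ≤ 1` the exponent on the right vanishes, and `4096 = 16 ^ 3` is the value at `k = 1`. For
`k ≥ 2` the number of colours is at most `k ^ 8` and `k + 2 ≤ 2 * k`; the factor `24` works because
`24 * log 2 ≥ 16`. -/
theorem numColors_pow_le (k : ℕ) :
    (numColors k : ℝ) ^ (k + 2) ≤ 4096 * (2 : ℝ) ^ (24 * (k * Real.log k)) := by
  rcases Nat.lt_or_ge k 2 with hk | hk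
  · interval_cases k
    · norm_num [numColors]
    · norm_num [numColors]
  · have h1 : numColors k ≤ k ^ 8 := by
      have h2 := two_pow_size_le k
      have h3 : 2 ^ k.size ≤ 3 * k := by omega
      have h4 : 64 ≤ k ^ 6 := by
        calc 64 = 2 ^ 6 := by norm_num
          _ ≤ k ^ 6 := Nat.pow_le_pow_left hk 6
      calc numColors k = 4 * (2 ^ k.size) ^ 2 := by rw [numColors]; ring
        _ ≤ 4 * (3 * k) ^ 2 := Nat.mul_le_mul_left _ (Nat.pow_le_pow_left h3 2)
        _ = 36 * k ^ 2 := by ring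
        _ ≤ k ^ 6 * k ^ 2 := Nat.mul_le_mul_right _ (by omega)
        _ = k ^ 8 := by ring
    have h2 : numColors k ^ (k + 2) ≤ k ^ (16 * k) :=
      calc numColors k ^ (k + 2) ≤ (k ^ 8) ^ (k + 2) := Nat.pow_le_pow_left h1 _
        _ = k ^ (8 * (k + 2)) := by rw [← pow_mul]
        _ ≤ k ^ (16 * k) := Nat.pow_le_pow_right (by omega) (by omega)
    have hk0 : (0 : ℝ) < k := by exact_mod_cast (by omega : 0 < k)
    have hlog : 0 ≤ (k : ℝ) * Real.log k :=
      mul_nonneg hk0.le (Real.log_nonneg (by exact_mod_cast (by omega : 1 ≤ k)))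
    have h3 : ((k : ℝ)) ^ (16 * k) ≤ (2 : ℝ) ^ (24 * (k * Real.log k)) := by
      rw [Real.rpow_def_of_pos two_pos, ← Real.exp_log hk0, ← Real.exp_nat_mul, Real.exp_log hk0]
      refine Real.exp_le_exp.2 ?_
      push_cast
      have := Real.log_two_gt_d9
      nlinarith
    calc (numColors k : ℝ) ^ (k + 2) ≤ (k : ℝ) ^ (16 * k) := by exact_mod_cast h2
      _ ≤ (2 : ℝ) ^ (24 * (k * Real.log k)) := h3
      _ ≤ _ := le_mul_of_one_le_left (by positivity) (by norm_num)

/-- Taking logarithms gives `(l + 1) * log 2 ≤ 3 * log (n + 2)`, and `3 / log 2 < 5`. -/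
theorem succ_le_log {l n : ℕ} (hl : 2 ^ l ≤ 2 * n + 1) :
    (l : ℝ) + 1 ≤ 5 * Real.log (n + 2) := by
  have hn : (2 : ℝ) ≤ (n : ℝ) + 2 := by linarith [(Nat.cast_nonneg n : (0 : ℝ) ≤ n)]
  have h1 : (2 : ℝ) ^ l ≤ 2 * (n + 2) := by
    have : (2 : ℝ) ^ l ≤ 2 * n + 1 := by exact_mod_cast hl
    linarith
  have h2 : (l : ℝ) * Real.log 2 ≤ Real.log 2 + Real.log (n + 2) := by
    rw [← Real.log_pow, ← Real.log_mul (by norm_num) (by linarith)]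
    exact Real.log_le_log (by positivity) h1
  have h3 : Real.log 2 ≤ Real.log (n + 2) := Real.log_le_log two_pos hn
  have h4 := Real.log_two_gt_d9
  nlinarith

end CQ

/-! ### The choice of constants and the final estimate. -/

theorem theorem4 :
    ∃ C : ℝ, 0 < C ∧
      ∀ (S : CQ.Schema) (q : CQ.Query S) (I : Finset (ℕ × ℕ)) (T : ℕ → ℕ → ℝ),
        q.SelfJoinFree →
        (∀ p ∈ I, p.1 ∈ q.vars ∧ p.2 ∈ q.vars) →
        Monotone (T q.size) →
        CQ.EvaluableInTime q ∅ (T q.size) →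
        CQ.EvaluableInTime q I (fun n =>
          C * (2 : ℝ) ^ (C * (CQ.ineqVars I).card * Real.log (CQ.ineqVars I).card)
            * Real.log (n + 2) * max (T q.size n) n) := by
  -- The prefactor has to exceed `2000 * 4096 * 5 = 40960000`; in the exponent `24` would suffice.
  refine ⟨50000000, by norm_num, fun S q I T hq hI hT ⟨p, hp⟩ => ?_⟩
  set k := (CQ.ineqVars I).card with hk
  refine ⟨CQ.mainProg q I p (CQ.numColors k), fun D => ?_⟩
  have hIK : 4 * I.card ≤ CQ.numColors k := by
    -- The inequalities are pairs of variables from `ineqVars I`, so there are at most `k ^ 2` of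
    -- them.
    refine le_trans (Nat.mul_le_mul_left _ ?_) (CQ.four_mul_sq_le_numColors k)
    rw [sq, hk, ← Finset.card_product]
    refine Finset.card_le_card fun e he => Finset.mem_product.2 ⟨?_, ?_⟩
    · exact Finset.mem_union_left _ (Finset.mem_image_of_mem _ he)
    · exact Finset.mem_union_right _ (Finset.mem_image_of_mem _ he)
  set τ := ⌊T q.size D.size⌋₊ with hτ
  have hrun : ∀ col req, ∃ s t, CQ.Exec p ⟨(D.restrict col req).initMem, []⟩ s t ∧ t ≤ τ ∧
      ∀ u, u ∈ s.out ↔ u ∈ q.answer ∅ (D.restrict col req) := fun col req => by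
    obtain ⟨s, t, hx, ht, -, hs⟩ := hp (D.restrict col req)
    -- A filtered database is no larger than `D`, so by monotonicity the time bound at `|D|` covers
    -- all runs.
    exact ⟨s, t, hx, Nat.le_floor (ht.trans (hT (D.size_restrict_le col req))), hs⟩
  have hτ1 : 1 ≤ τ := by
    obtain ⟨s, t, hx, ht, -⟩ := hp D
    exact hx.one_le.trans (Nat.le_floor ht)
  obtain ⟨l, hl, m', o, t, hx, ht, hnd, ho⟩ := CQ.run_mainProg hq hI hIK hrun
  refine ⟨⟨m', o⟩, t, hx, ?_, hnd, ho⟩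
  have hbound : t ≤ 2000 * (CQ.numColors k ^ (k + 2) * (l + 1) * max τ D.size) :=
    ht.trans (CQ.total_le (Nat.one_le_two_pow) hτ1 hl)
  have hT0 : 0 ≤ T q.size D.size := by
    by_contra! h
    rw [hτ, Nat.floor_of_nonpos h.le] at hτ1
    omega
  have hmax : ((max τ D.size : ℕ) : ℝ) ≤ max (T q.size D.size) D.size := by
    rw [Nat.cast_max]
    exact max_le_max (Nat.floor_le hT0) le_rfl
  have hlog := CQ.succ_le_log hl
  have hcol := CQ.numColors_pow_le k
  have hexp : (2 : ℝ) ^ (24 * (k * Real.log k)) ≤ (2 : ℝ) ^ (50000000 * k * Real.log k) := by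
    refine Real.rpow_le_rpow_of_exponent_le one_le_two ?_
    have : 0 ≤ (k : ℝ) * Real.log k := mul_nonneg (Nat.cast_nonneg _) (Real.log_natCast_nonneg _)
    nlinarith
  have hlog0 : 0 ≤ Real.log ((D.size : ℝ) + 2) := Real.log_nonneg (by
    linarith [(Nat.cast_nonneg D.size : (0 : ℝ) ≤ D.size)])
  have hmax0 : 0 ≤ max (T q.size D.size) (D.size : ℝ) := le_max_of_le_left hT0
  calc (t : ℝ) ≤ 2000 * ((CQ.numColors k : ℝ) ^ (k + 2) * (l + 1) * (max τ D.size : ℕ)) := by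
        exact_mod_cast hbound
    _ ≤ 2000 * ((4096 * (2 : ℝ) ^ (50000000 * k * Real.log k)) *
        (5 * Real.log (D.size + 2)) * max (T q.size D.size) D.size) := by
        have := hcol.trans (mul_le_mul_of_nonneg_left hexp (by norm_num : (0 : ℝ) ≤ 4096))
        gcongr
    _ = 40960000 * ((2 : ℝ) ^ (50000000 * k * Real.log k) * Real.log (D.size + 2) *
        max (T q.size D.size) D.size) := by ring
    _ ≤ 50000000 * ((2 : ℝ) ^ (50000000 * k * Real.log k) * Real.log (D.size + 2) *
        max (T q.size D.size) D.size) :=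
        mul_le_mul_of_nonneg_right (by norm_num) (by positivity)
    _ = _ := by ring
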